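/- **Theorem T1.75 (Strict inverse energy inequality).** Let $\mathcal F_{\mathrm{rad}}=\bigoplus_{n\ge 0}\bigotimes_s^n L^2(\mathbb R^3\times\{1,2\})$ be the photon (boson) Fock space, with annihilation and creation operators $a(f),a(f)^*$ and second quantizations $d\Gamma(h)$ of multiplication operators by functions $h$ of the momentum $\mathbf k$. Let $\alpha_1,\alpha_2,\alpha_3,\beta$ be $4\times4$ Dirac matrices (Hermitian, mutually anticommuting, with squares equal to $1$), and let $\mathbf e^{(1)},\mathbf e^{(2)}:\mathbb R^3\to\mathbb R^3$ be Borel measurable polarization vectors, i.e. $\mathbf e^{(\lambda)}(\mathbf k)\cdot\mathbf e^{(\mu)}(\mathbf k)=\delta_{\lambda\mu}$ and $\mathbf e^{(\lambda)}(\mathbf k)\cdot\mathbf k=0$ for all $\mathbf k$. Let $\rho\in L^2(\mathbb R^3;\mathbb C)$ with $|\mathbf k|^{-1}\rho\in L^2(\mathbb R^3)$, let $M,q\in\mathbb R$ and $m\ge 0$, and put $$g_j(\mathbf k,\lambda)=|\mathbf k|^{-1/2}\rho(\mathbf k)e^{(\lambda)}_j(\mathbf k),\qquad A_j=\tfrac1{\sqrt2}\,\overline{a(g_j)+a(g_j)^*},\qquad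 \omega_m(\mathbf k)=(1+m)|\mathbf k|+m .$$ For $\mathbf p\in\mathbb R^3$ define on $\mathbb C^4\otimes\mathcal F_{\mathrm{rad}}$ the operator $$H_m(\mathbf p)=\vec\alpha\cdot\mathbf p+M\beta+d\Gamma(\omega_m)-\vec\alpha\cdot d\Gamma(\mathbf k)-q\,\vec\alpha\cdot\mathbf A ,\qquad E_m(\mathbf p)=\inf\sigma\big(\overline{H_m(\mathbf p)}\big).$$ Assume that $|\rho(\mathbf k)|=|\rho(-\mathbf k)|$ for almost every $\mathbf k\in\mathbb R^3$, and that $\overline{H_m(0)}$ has a ground state, i.e. $E_m(0)$ is a (finite) eigenvalue of $\overline{H_m(0)}$. Then, for every $\mathbf p\in\mathbb R^3$ with $\mathbf p\neq0$, $$-\infty<E_m(\mathbf p)<E_m(0).$$ -/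

import Mathlib

open MeasureTheory

noncomputable section

namespace DiracPolaron

/-! ### Spectrum and ground states of unbounded operators -/

section Spectrum

variable {E : Type*} [NormedAddCommGroup E] [InnerProductSpace ℂ E]

/-- `z` is in the resolvent set of `T`: the operator `T - z` is a bijection of its domain onto the
whole space, with a bounded inverse `R`. -/
def InResolventSet (T : E →ₗ.[ℂ] E) (z : ℂ) : Prop :=
  ∃ R : E →L[ℂ] E,
    (∀ y : E, ∃ h : R y ∈ T.domain, T ⟨R y, h⟩ - z • R y = y) ∧
    ∀ x : T.domain, R (T x - z • (x : E)) = x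

/-- The spectrum of an unbounded operator. -/
def opSpectrum (T : E →ₗ.[ℂ] E) : Set ℂ := {z | ¬ InResolventSet T z}

/-- The infimum of the (real) spectrum, as an extended real number: it is `⊥` when the spectrum is
not bounded below. -/
def infSpectrum (T : E →ₗ.[ℂ] E) : EReal :=
  sInf ((fun x : ℝ => (x : EReal)) '' {x : ℝ | (x : ℂ) ∈ opSpectrum T})

/-- `z` is an eigenvalue of `T`. -/
def IsEigenvalue (T : E →ₗ.[ℂ] E) (z : ℂ) : Prop :=
  ∃ x : T.domain, (x : E) ≠ 0 ∧ T x = z • (x : E)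

/-- `T` has a ground state: the infimum of its spectrum is (a real number and) an eigenvalue. -/
def HasGroundState (T : E →ₗ.[ℂ] E) : Prop :=
  ∃ x : ℝ, infSpectrum T = (x : EReal) ∧ IsEigenvalue T (x : ℂ)

end Spectrum

/-! ### The photon Fock space -/

/-- Three-dimensional Euclidean (momentum) space. -/
abbrev R3 : Type := EuclideanSpace ℝ (Fin 3)

/-- One-photon configurations `(k, μ)`: momentum and polarization index. -/
abbrev Photon : Type := R3 × Fin 2

/-- Lebesgue measure times counting measure. -/
def photonMeasure : Measure Photon := (volume : Measure R3).prod Measure.count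

instance : SigmaFinite photonMeasure := by unfold photonMeasure; infer_instance

/-- The product measure on `n`-photon configurations. -/
abbrev photonMeasureN (n : ℕ) : Measure (Fin n → Photon) :=
  Measure.pi fun _ : Fin n => photonMeasure

lemma measurePreserving_perm {n : ℕ} (s : Equiv.Perm (Fin n)) :
    MeasurePreserving (fun x : Fin n → Photon => fun i => x (s i))
      (photonMeasureN n) (photonMeasureN n) := by
  have h := measurePreserving_piCongrLeft (fun _ : Fin n => photonMeasure) s.symm
  convert h using 1
  funext x i
  have := MeasurableEquiv.piCongrLeft_apply_apply (β := fun _ : Fin n => Photon) s.symm x (s i)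
  simpa using this.symm

lemma ae_cons {n : ℕ} {s : (Fin (n + 1) → Photon) → Prop}
    (h : ∀ᵐ z ∂(photonMeasureN (n + 1)), s z) :
    ∀ᵐ x ∂(photonMeasureN n), ∀ᵐ y ∂photonMeasure, s (Fin.cons y x) := by
  have h1 := (measurePreserving_piFinSuccAbove
    (fun _ : Fin (n + 1) => photonMeasure) 0).symm.quasiMeasurePreserving.ae h
  have h2 := (Measure.measurePreserving_swap (μ := photonMeasureN n)
    (ν := photonMeasure)).quasiMeasurePreserving.ae h1
  filter_upwards [Measure.ae_ae_of_ae_prod h2] with x hx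
  filter_upwards [hx] with y hy
  have h3 : (MeasurableEquiv.piFinSuccAbove (fun _ : Fin (n + 1) => Photon) 0).symm
      ((x, y) : (Fin n → Photon) × Photon).swap = Fin.cons y x := by
    simp [MeasurableEquiv.piFinSuccAbove, Fin.consEquiv]
  rwa [h3] at hy

lemma ae_remove {n : ℕ} (j : Fin (n + 1)) {s : (Fin n → Photon) → Prop}
    (h : ∀ᵐ z ∂(photonMeasureN n), s z) :
    ∀ᵐ x ∂(photonMeasureN (n + 1)), s (fun i => x (j.succAbove i)) := by
  have h1 := (measurePreserving_piFinSuccAbove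
    (fun _ : Fin (n + 1) => photonMeasure) j).quasiMeasurePreserving.ae
    (Measure.quasiMeasurePreserving_snd.ae h)
  filter_upwards [h1] with x hx
  exact hx

/-- The `n`-fold symmetric tensor power of `L²(ℝ³ × {1,2})`, realized as the space of permutation
symmetric functions in `L²((ℝ³ × {1,2})ⁿ)`. -/
def NPhoton (n : ℕ) : Submodule ℂ (Lp ℂ 2 (photonMeasureN n)) where
  carrier := {f | ∀ s : Equiv.Perm (Fin n),
    ∀ᵐ x ∂(photonMeasureN n), f (fun i => x (s i)) = f x}
  add_mem' := by
    intro f g hf hg s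
    filter_upwards [hf s, hg s, Lp.coeFn_add f g,
      (measurePreserving_perm s).quasiMeasurePreserving.ae (Lp.coeFn_add f g)] with x h1 h2 h3 h4
    rw [h3, h4, Pi.add_apply, Pi.add_apply, h1, h2]
  zero_mem' := by
    intro s
    filter_upwards [Lp.coeFn_zero ℂ 2 (photonMeasureN n),
      (measurePreserving_perm s).quasiMeasurePreserving.ae
        (Lp.coeFn_zero ℂ 2 (photonMeasureN n))] with x h3 h4
    rw [h3, h4, Pi.zero_apply, Pi.zero_apply]
  smul_mem' := by
    intro c f hf s
    filter_upwards [hf s, Lp.coeFn_smul c f,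
      (measurePreserving_perm s).quasiMeasurePreserving.ae (Lp.coeFn_smul c f)] with x h1 h3 h4
    rw [h3, h4, Pi.smul_apply, Pi.smul_apply, h1]

/-- The boson Fock space: the Hilbert space direct sum of the `n`-photon spaces. -/
abbrev Fock : Type := lp (fun n : ℕ => NPhoton n) 2

/-- The `n`-photon wave function of a Fock vector. -/
def comp (Ψ : Fock) (n : ℕ) : (Fin n → Photon) → ℂ := ((Ψ n : Lp ℂ 2 (photonMeasureN n)) :)

lemma comp_add (Ψ Φ : Fock) (n : ℕ) :
    ∀ᵐ x ∂(photonMeasureN n), comp (Ψ + Φ) n x = comp Ψ n x + comp Φ n x :=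
  Lp.coeFn_add (Ψ n : Lp ℂ 2 (photonMeasureN n)) (Φ n)

lemma comp_smul (c : ℂ) (Ψ : Fock) (n : ℕ) :
    ∀ᵐ x ∂(photonMeasureN n), comp (c • Ψ) n x = c * comp Ψ n x :=
  Lp.coeFn_smul c (Ψ n : Lp ℂ 2 (photonMeasureN n))

lemma comp_zero (n : ℕ) : ∀ᵐ x ∂(photonMeasureN n), comp 0 n x = 0 :=
  Lp.coeFn_zero ℂ 2 (photonMeasureN n)

lemma ext_comp {Ψ Φ : Fock}
    (h : ∀ n, ∀ᵐ x ∂(photonMeasureN n), comp Ψ n x = comp Φ n x) : Ψ = Φ := by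
  apply lp.ext
  funext n
  exact Subtype.ext (Lp.ext (h n))

/-! ### Second quantization, annihilation and creation operators

Each operator is given by its graph, on its maximal domain: `Ψ` is in the domain exactly when the
displayed formula defines an element of the Fock space. -/

/-- Graph of `dΓ(h)`: on `n`-photon functions it multiplies by `h(x₁) + ⋯ + h(xₙ)`. -/
def dGammaGraph (h : R3 → ℝ) : Submodule ℂ (Fock × Fock) where
  carrier := {P | ∀ n, ∀ᵐ x ∂(photonMeasureN n),
    comp P.2 n x = ((∑ i, h (x i).1 : ℝ) : ℂ) * comp P.1 n x}
  add_mem' := by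
    intro P Q hP hQ n
    filter_upwards [hP n, hQ n, comp_add P.1 Q.1 n, comp_add P.2 Q.2 n] with x h1 h2 h3 h4
    rw [Prod.fst_add, Prod.snd_add, h3, h4, h1, h2, mul_add]
  zero_mem' := by
    intro n
    filter_upwards [comp_zero n] with x h1
    rw [Prod.fst_zero, Prod.snd_zero, h1, mul_zero]
  smul_mem' := by
    intro c P hP n
    filter_upwards [hP n, comp_smul c P.1 n, comp_smul c P.2 n] with x h1 h3 h4
    rw [Prod.smul_fst, Prod.smul_snd, h3, h4, h1]
    ring

/-- The second quantization `dΓ(h)` of the multiplication operator by the function `h(k)`. -/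
def dGamma (h : R3 → ℝ) : Fock →ₗ.[ℂ] Fock := (dGammaGraph h).toLinearPMap

/-- The graph of `dΓ(h)` is indeed `dGammaGraph h`. -/
lemma dGamma_graph (h : R3 → ℝ) : (dGamma h).graph = dGammaGraph h := by
  refine Submodule.toLinearPMap_graph_eq _ fun P hP h0 => ext_comp fun n => ?_
  filter_upwards [hP n, comp_zero n] with x h1 h2
  rw [h1, h0, h2, mul_zero]

/-- Graph of the annihilation operator:
`(a(f)Ψ)ₙ(x₁,…,xₙ) = √(n+1) ∫ conj f(y) Ψₙ₊₁(y,x₁,…,xₙ) dy`. -/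
def annihilationGraph (f : Photon → ℂ) : Submodule ℂ (Fock × Fock) where
  carrier := {P | ∀ n, ∀ᵐ x ∂(photonMeasureN n),
    Integrable (fun y => (starRingEnd ℂ) (f y) *
      comp P.1 (n + 1) (Fin.cons y x : Fin (n + 1) → Photon)) photonMeasure ∧
    comp P.2 n x = (Real.sqrt (n + 1) : ℂ) * ∫ y, (starRingEnd ℂ) (f y) *
      comp P.1 (n + 1) (Fin.cons y x : Fin (n + 1) → Photon) ∂photonMeasure}
  add_mem' := by
    intro P Q hP hQ n
    filter_upwards [hP n, hQ n, ae_cons (comp_add P.1 Q.1 (n + 1)), comp_add P.2 Q.2 n] with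
      x h1 h2 h3 h4
    have h5 : (fun y => (starRingEnd ℂ) (f y) *
          comp (P + Q).1 (n + 1) (Fin.cons y x : Fin (n + 1) → Photon)) =ᵐ[photonMeasure]
        fun y => (starRingEnd ℂ) (f y) * comp P.1 (n + 1) (Fin.cons y x : Fin (n + 1) → Photon)
          + (starRingEnd ℂ) (f y) * comp Q.1 (n + 1) (Fin.cons y x : Fin (n + 1) → Photon) := by
      filter_upwards [h3] with y hy
      rw [Prod.fst_add, hy, mul_add]
    refine ⟨(h1.1.add h2.1).congr h5.symm, ?_⟩
    rw [integral_congr_ae h5, integral_add h1.1 h2.1, Prod.snd_add, h4, h1.2, h2.2, mul_add]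
  zero_mem' := by
    intro n
    filter_upwards [ae_cons (comp_zero (n + 1)), comp_zero n] with x h3 h4
    have h5 : (fun y => (starRingEnd ℂ) (f y) *
          comp (0 : Fock × Fock).1 (n + 1) (Fin.cons y x : Fin (n + 1) → Photon))
        =ᵐ[photonMeasure] fun _ => 0 := by
      filter_upwards [h3] with y hy
      rw [Prod.fst_zero, hy, mul_zero]
    refine ⟨(integrable_zero _ _ _).congr h5.symm, ?_⟩
    rw [integral_congr_ae h5, Prod.snd_zero, h4]
    simp
  smul_mem' := by
    intro c P hP n
    filter_upwards [hP n, ae_cons (comp_smul c P.1 (n + 1)), comp_smul c P.2 n] with x h1 h3 h4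
    have h5 : (fun y => (starRingEnd ℂ) (f y) *
          comp (c • P).1 (n + 1) (Fin.cons y x : Fin (n + 1) → Photon)) =ᵐ[photonMeasure]
        fun y => c * ((starRingEnd ℂ) (f y) *
          comp P.1 (n + 1) (Fin.cons y x : Fin (n + 1) → Photon)) := by
      filter_upwards [h3] with y hy
      rw [Prod.smul_fst, hy]
      ring
    refine ⟨(h1.1.const_mul c).congr h5.symm, ?_⟩
    rw [integral_congr_ae h5, integral_const_mul, Prod.smul_snd, h4, h1.2]
    ring

/-- The annihilation operator `a(f)`, antilinear in `f`. -/
def annihilation (f : Photon → ℂ) : Fock →ₗ.[ℂ] Fock := (annihilationGraph f).toLinearPMap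

/-- The graph of `a(f)` is indeed `annihilationGraph f`. -/
lemma annihilation_graph (f : Photon → ℂ) :
    (annihilation f).graph = annihilationGraph f := by
  refine Submodule.toLinearPMap_graph_eq _ fun P hP h0 => ext_comp fun n => ?_
  filter_upwards [hP n, ae_cons (comp_zero (n + 1)), comp_zero n] with x h1 h2 h3
  rw [h1.2, h0, h3, integral_eq_zero_of_ae, mul_zero]
  filter_upwards [h2] with y hy
  rw [hy, mul_zero, Pi.zero_apply]

/-- Graph of the creation operator: `(a(f)*Ψ)₀ = 0` and
`(a(f)*Ψ)ₙ₊₁(x₀,…,xₙ) = (n+1)^(-1/2) ∑ⱼ f(xⱼ) Ψₙ(x₀,…,xⱼ₋₁,xⱼ₊₁,…,xₙ)`. -/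
def creationGraph (f : Photon → ℂ) : Submodule ℂ (Fock × Fock) where
  carrier := {P | (∀ᵐ x ∂(photonMeasureN 0), comp P.2 0 x = 0) ∧
    ∀ n, ∀ᵐ x ∂(photonMeasureN (n + 1)),
      comp P.2 (n + 1) x = ((Real.sqrt (n + 1))⁻¹ : ℂ) *
        ∑ j : Fin (n + 1), f (x j) * comp P.1 n (fun i => x (j.succAbove i))}
  add_mem' := by
    intro P Q hP hQ
    refine ⟨?_, fun n => ?_⟩
    · filter_upwards [hP.1, hQ.1, comp_add P.2 Q.2 0] with x h1 h2 h3
      rw [Prod.snd_add, h3, h1, h2, add_zero]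
    · filter_upwards [hP.2 n, hQ.2 n, ae_all_iff.2 fun j => ae_remove j (comp_add P.1 Q.1 n),
        comp_add P.2 Q.2 (n + 1)] with x h1 h2 h3 h4
      rw [Prod.snd_add, h4, h1, h2, ← mul_add, ← Finset.sum_add_distrib]
      congr 1
      refine Finset.sum_congr rfl fun j _ => ?_
      rw [Prod.fst_add, h3 j, mul_add]
  zero_mem' := by
    refine ⟨comp_zero 0, fun n => ?_⟩
    filter_upwards [ae_all_iff.2 fun j => ae_remove j (comp_zero n), comp_zero (n + 1)] with
      x h3 h4
    rw [Prod.snd_zero, h4, Finset.sum_eq_zero, mul_zero]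
    intro j _
    rw [Prod.fst_zero, h3 j, mul_zero]
  smul_mem' := by
    intro c P hP
    refine ⟨?_, fun n => ?_⟩
    · filter_upwards [hP.1, comp_smul c P.2 0] with x h1 h3
      rw [Prod.smul_snd, h3, h1, mul_zero]
    · filter_upwards [hP.2 n, ae_all_iff.2 fun j => ae_remove j (comp_smul c P.1 n),
        comp_smul c P.2 (n + 1)] with x h1 h3 h4
      rw [Prod.smul_snd, h4, h1, mul_left_comm, Finset.mul_sum]
      congr 1
      refine Finset.sum_congr rfl fun j _ => ?_
      rw [Prod.smul_fst, h3 j, mul_left_comm]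

/-- The creation operator `a(f)*`. -/
def creation (f : Photon → ℂ) : Fock →ₗ.[ℂ] Fock := (creationGraph f).toLinearPMap

/-- The graph of `a(f)*` is indeed `creationGraph f`. -/
lemma creation_graph (f : Photon → ℂ) : (creation f).graph = creationGraph f := by
  refine Submodule.toLinearPMap_graph_eq _ fun P hP h0 => ext_comp fun n => ?_
  cases n with
  | zero =>
    filter_upwards [hP.1, comp_zero 0] with x h1 h2
    rw [h1, h2]
  | succ n =>
    filter_upwards [hP.2 n, ae_all_iff.2 fun j => ae_remove j (comp_zero n),
      comp_zero (n + 1)] with x h1 h2 h3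
    rw [h1, h3, Finset.sum_eq_zero, mul_zero]
    intro j _
    rw [h0, h2 j, mul_zero]

/-- The Segal field operator: the closure of `a(f) + a(f)*`, divided by `√2`. -/
def segalField (f : Photon → ℂ) : Fock →ₗ.[ℂ] Fock :=
  ((Real.sqrt 2)⁻¹ : ℂ) • (annihilation f + creation f).closure

/-! ### The fibre Hamiltonian -/

/-- Polarization vectors: Borel maps `e⁽¹⁾, e⁽²⁾ : ℝ³ → ℝ³` which at each `k` are orthonormal and
orthogonal to `k`. -/
structure IsPolarization (e : Fin 2 → R3 → R3) : Prop where
  measurable : ∀ l, Measurable (e l)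
  orthonormal : ∀ k l l', inner ℝ (e l k) (e l' k) = if l = l' then 1 else 0
  transverse : ∀ k l, inner ℝ (e l k) k = 0

/-- `4 × 4` Dirac matrices: Hermitian, mutually anticommuting, with squares equal to `1`. -/
structure IsDirac (α : Fin 3 → Matrix (Fin 4) (Fin 4) ℂ) (β : Matrix (Fin 4) (Fin 4) ℂ) :
    Prop where
  hermitian_alpha : ∀ j, (α j).IsHermitian
  hermitian_beta : β.IsHermitian
  alpha_alpha : ∀ j l, α j * α l + α l * α j = if j = l then 2 else 0
  alpha_beta : ∀ j, α j * β + β * α j = 0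
  beta_sq : β * β = 1

/-- The form factor `gⱼ(k, l) = |k|^(-1/2) ρ(k) eⱼ⁽ˡ⁾(k)` of the vector potential at the origin. -/
def formFactor (ρ : R3 → ℂ) (e : Fin 2 → R3 → R3) (j : Fin 3) (x : Photon) : ℂ :=
  ((‖x.1‖ ^ (-(1 / 2) : ℝ) : ℝ) : ℂ) * ρ x.1 * (e x.2 x.1 j : ℂ)

/-- The quantized vector potential at the origin. -/
def vectorPotential (ρ : R3 → ℂ) (e : Fin 2 → R3 → R3) (j : Fin 3) : Fock →ₗ.[ℂ] Fock :=
  segalField (formFactor ρ e j)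

/-- The fibre Hilbert space `ℂ⁴ ⊗ Fock`, realized as the fourfold Hilbert sum of the Fock space. -/
abbrev Fibre : Type := PiLp 2 (fun _ : Fin 4 => Fock)

/-- The operator `B ⊗ T` on the fibre space, for a matrix `B` and an operator `T` on Fock space:
`((B ⊗ T) Ψ)ᵢ = ∑ⱼ Bᵢⱼ T Ψⱼ`, defined when all components of `Ψ` are in the domain of `T`. -/
def matTensor (B : Matrix (Fin 4) (Fin 4) ℂ) (T : Fock →ₗ.[ℂ] Fock) : Fibre →ₗ.[ℂ] Fibre where
  domain :=
    { carrier := {Ψ | ∀ i, Ψ i ∈ T.domain}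
      add_mem' := fun h h' i => T.domain.add_mem (h i) (h' i)
      zero_mem' := fun _ => T.domain.zero_mem
      smul_mem' := fun c _ h i => T.domain.smul_mem c (h i) }
  toFun :=
    { toFun := fun Ψ => WithLp.toLp 2 fun i => ∑ j, B i j • T ⟨Ψ.1 j, Ψ.2 j⟩
      map_add' := by
        intro Ψ Φ
        ext1 i
        simp only [PiLp.add_apply, ← Finset.sum_add_distrib, ← smul_add, ← T.map_add]
        rfl
      map_smul' := by
        intro c Ψ
        ext1 i
        simp only [PiLp.smul_apply, Finset.smul_sum, smul_comm c, ← T.map_smul,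
          RingHom.id_apply]
        rfl }

/-- The photon dispersion relation `ω_m(k) = (1 + m)|k| + m`. -/
def dispersion (m : ℝ) (k : R3) : ℝ := (1 + m) * ‖k‖ + m

/-- The fibre Hamiltonian
`H_m(p) = α·p + Mβ + dΓ(ω_m) - α·dΓ(k) - q α·A`, on the intersection of the domains. -/
def hamiltonian (α : Fin 3 → Matrix (Fin 4) (Fin 4) ℂ) (β : Matrix (Fin 4) (Fin 4) ℂ)
    (M q m : ℝ) (ρ : R3 → ℂ) (e : Fin 2 → R3 → R3) (p : R3) : Fibre →ₗ.[ℂ] Fibre :=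
  matTensor ((∑ j, (p j : ℂ) • α j) + (M : ℂ) • β) (LinearMap.id.toPMap ⊤)
    + matTensor 1 (dGamma (dispersion m))
    - (∑ j, matTensor (α j) (dGamma fun k => k j))
    - (q : ℂ) • (∑ j, matTensor (α j) (vectorPotential ρ e j))

/-- The ground state energy `E_m(p)`: the infimum of the spectrum of the closure of `H_m(p)`. -/
def energy (α : Fin 3 → Matrix (Fin 4) (Fin 4) ℂ) (β : Matrix (Fin 4) (Fin 4) ℂ)
    (M q m : ℝ) (ρ : R3 → ℂ) (e : Fin 2 → R3 → R3) (p : R3) : EReal :=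
  infSpectrum (hamiltonian α β M q m ρ e p).closure

end DiracPolaron

end

/-!
Replacing the total momentum `0` by `p` adds the bounded operator `α·p` to the Hamiltonian, on the
same domain (`hamiltonian_eq_addBounded`), and this passes to closures. Let `T` be the closure of
`H_m(0)`, `E₀` its ground state energy and `Ψ` a ground state.

*Symmetry.* `dΓ(h)` is symmetric, and so is the Segal field because `a(f)` and `a(f)*` are formally
adjoint (`inner_creation`); hence `T` is symmetric. If every real `z < E₀` is in the resolvent set
of a symmetric operator, then its resolvents at these points are nonnegative bounded operators, so
that the operator is bounded below by `E₀` as a form (`le_form_of_inResolventSet`). A Neumann series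
then gives `-∞ < E_m(p)`.

*Parity.* For almost every `k`, `|ρ(k)| = |ρ(-k)|`, and the polarization vectors at `k` and at `-k`
are orthonormal bases of the same plane. So there are unitary `2 × 2` matrices `w(k)`, namely the
matrices `-ρ(k)/ρ(-k) e_a(k)·e_b(-k)`, such that the one-photon unitary
`(u f)(k,a) = ∑_b w(k)_{ab} f(-k,b)` changes the sign of each form factor `g_j`
(`reflect_formFactor`). Its second quantization `Γ` commutes with `dΓ(ω_m)` and anticommutes
with `dΓ(k_j)` and with `A_j`. As `β` anticommutes with the `α_j`, the isometry `β ⊗ Γ` commutes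
with `T` and anticommutes with `α·p`.

*Strictness.* If `E_m(p) ≥ E₀`, then `T + α·p ≥ E₀` as forms. Testing this with `Ψ` and with its
parity transform, whose expectations of `α·p` are opposite, shows that `⟨Ψ, α·p Ψ⟩ = 0`. Thus `Ψ`
minimizes the form of `T + α·p`, and is an eigenvector of it with eigenvalue `E₀`
(`eq_smul_of_form_eq`). Therefore `α·p Ψ = 0`, and `(α·p)² = |p|²` forces `Ψ = 0`, a
contradiction (`infSpectrum_addBounded_lt`).
-/

noncomputable section

namespace DiracPolaron

/-! ### Lower bounds of symmetric operators from their resolvent sets -/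

section Operators

variable {E : Type*} [NormedAddCommGroup E] [InnerProductSpace ℂ E]

lemma closure_graph_cases (T : E →ₗ.[ℂ] E) :
    T.closure = T ∨ T.closure.graph = T.graph.topologicalClosure := by
  by_cases h : T.IsClosable
  · exact .inr h.graph_closure_eq_closure_graph.symm
  · exact .inl (LinearPMap.closure_def' h)

/-- A continuous linear map preserving the graph of `T` preserves the graph of its closure. -/
lemma closure_graph_mapsTo {T : E →ₗ.[ℂ] E} (L : E × E →L[ℂ] E × E)
    (hL : ∀ z ∈ T.graph, L z ∈ T.graph) : ∀ z ∈ T.closure.graph, L z ∈ T.closure.graph := by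
  rcases closure_graph_cases T with h | h
  · rwa [h]
  · intro z hz
    rw [h] at hz ⊢
    exact map_mem_closure L.continuous hz hL

lemma isFormalAdjoint_iff_graph {T : E →ₗ.[ℂ] E} :
    T.IsFormalAdjoint T ↔
      ∀ z ∈ T.graph, ∀ w ∈ T.graph, inner ℂ z.2 w.1 = inner ℂ z.1 w.2 := by
  constructor
  · intro h z hz w hw
    obtain ⟨x, hx, hx'⟩ := T.mem_graph_iff.1 hz
    obtain ⟨y, hy, hy'⟩ := T.mem_graph_iff.1 hw
    rw [← hx, ← hx', ← hy, ← hy']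
    exact h x y
  · intro h x y
    exact h _ (T.mem_graph x) _ (T.mem_graph y)

/-- The closure of a symmetric operator is symmetric. No density of the domain is required: if the
operator is not closable, `LinearPMap.closure` returns the operator itself. -/
lemma isFormalAdjoint_closure {T : E →ₗ.[ℂ] E} (hT : T.IsFormalAdjoint T) :
    T.closure.IsFormalAdjoint T.closure := by
  rcases closure_graph_cases T with h | h
  · rwa [h]
  · rw [isFormalAdjoint_iff_graph] at hT ⊢
    rw [h]
    have key : ∀ p ∈ closure ((T.graph : Set (E × E)) ×ˢ (T.graph : Set (E × E))),
        inner ℂ p.1.2 p.2.1 = inner ℂ p.1.1 p.2.2 := by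
      refine fun p hp => closure_minimal (s := (T.graph : Set (E × E)) ×ˢ (T.graph : Set (E × E)))
        (t := {p | inner ℂ p.1.2 p.2.1 = inner ℂ p.1.1 p.2.2})
        (fun p hp => hT _ hp.1 _ hp.2) (isClosed_eq (by fun_prop) (by fun_prop)) hp
    intro z hz w hw
    exact key (z, w) (by rw [closure_prod_eq]; exact ⟨hz, hw⟩)

/-- The sum of an operator and a bounded operator, on the domain of the former. -/
def addBounded (T : E →ₗ.[ℂ] E) (B : E →L[ℂ] E) : E →ₗ.[ℂ] E where
  domain := T.domain
  toFun := T.toFun + (B : E →ₗ[ℂ] E).comp T.domain.subtype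

lemma mem_graph_addBounded {T : E →ₗ.[ℂ] E} {B : E →L[ℂ] E} {z : E × E} :
    z ∈ (addBounded T B).graph ↔ (z.1, z.2 - B z.1) ∈ T.graph := by
  simp only [LinearPMap.mem_graph_iff]
  constructor
  · rintro ⟨y, hy, hy'⟩
    refine ⟨y, hy, ?_⟩
    rw [← hy', ← hy]
    exact (add_sub_cancel_right (T y) (B y)).symm
  · rintro ⟨y, hy, hy'⟩
    refine ⟨y, hy, ?_⟩
    have h : T y + B y = z.2 := by rw [hy', hy]; simp
    exact h

lemma addBounded_addBounded_neg (T : E →ₗ.[ℂ] E) (B : E →L[ℂ] E) :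
    addBounded (addBounded T B) (-B) = T := by
  apply LinearPMap.eq_of_eq_graph
  ext z
  rw [mem_graph_addBounded, mem_graph_addBounded]
  simp

lemma topologicalClosure_graph_addBounded_le (T : E →ₗ.[ℂ] E) (B : E →L[ℂ] E) {z : E × E}
    (hz : z ∈ (addBounded T B).graph.topologicalClosure) :
    (z.1, z.2 - B z.1) ∈ T.graph.topologicalClosure :=
  map_mem_closure (f := fun z : E × E => (z.1, z.2 - B z.1)) (by fun_prop) hz
    fun _ hw => mem_graph_addBounded.1 hw

lemma topologicalClosure_graph_addBounded (T : E →ₗ.[ℂ] E) (B : E →L[ℂ] E) {z : E × E} :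
    z ∈ (addBounded T B).graph.topologicalClosure ↔
      (z.1, z.2 - B z.1) ∈ T.graph.topologicalClosure := by
  refine ⟨topologicalClosure_graph_addBounded_le T B, fun h => ?_⟩
  rw [← addBounded_addBounded_neg T B] at h
  simpa using topologicalClosure_graph_addBounded_le _ _ h

lemma isClosable_addBounded {T : E →ₗ.[ℂ] E} (B : E →L[ℂ] E) (h : T.IsClosable) :
    (addBounded T B).IsClosable := by
  obtain ⟨S, hS⟩ := h
  refine ⟨addBounded S B, ?_⟩
  ext z
  rw [topologicalClosure_graph_addBounded, mem_graph_addBounded, hS]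

/-- Adding a bounded operator commutes with taking closures (and preserves closability). -/
lemma closure_addBounded (T : E →ₗ.[ℂ] E) (B : E →L[ℂ] E) :
    (addBounded T B).closure = addBounded T.closure B := by
  by_cases h : T.IsClosable
  · apply LinearPMap.eq_of_eq_graph
    ext z
    rw [← (isClosable_addBounded B h).graph_closure_eq_closure_graph,
      topologicalClosure_graph_addBounded, mem_graph_addBounded,
      h.graph_closure_eq_closure_graph]
  · have h' : ¬ (addBounded T B).IsClosable := fun h' => h <| by
      simpa [addBounded_addBounded_neg] using isClosable_addBounded (-B) h'
    rw [LinearPMap.closure_def' h, LinearPMap.closure_def' h']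

lemma isFormalAdjoint_addBounded {T : E →ₗ.[ℂ] E} {B : E →L[ℂ] E} (hT : T.IsFormalAdjoint T)
    (hB : ∀ x y, inner ℂ (B x) y = inner ℂ x (B y)) :
    (addBounded T B).IsFormalAdjoint (addBounded T B) := by
  intro x y
  have h1 : addBounded T B x = T x + B x := rfl
  have h2 : addBounded T B y = T y + B y := rfl
  rw [h1, h2, inner_add_left, inner_add_right, hB]
  exact congrArg (· + _) (hT x y)

lemma re_inner_ofReal_smul_self (c : ℝ) (y : E) :
    (inner ℂ ((c : ℂ) • y) y).re = c * ‖y‖ ^ 2 := by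
  rw [inner_smul_left, Complex.conj_ofReal, Complex.re_ofReal_mul]
  congr 1
  exact inner_self_eq_norm_sq (𝕜 := ℂ) y

/-- Resolvents of a symmetric operator at real points are symmetric. -/
lemma inner_resolvent {T : E →ₗ.[ℂ] E} (hT : T.IsFormalAdjoint T) {z : ℝ} {R : E →L[ℂ] E}
    (hd : ∀ y, R y ∈ T.domain) (hR : ∀ y, T ⟨R y, hd y⟩ - (z : ℂ) • R y = y) (a b : E) :
    inner ℂ (R a) b = inner ℂ a (R b) := by
  have h1 := hT ⟨R a, hd a⟩ ⟨R b, hd b⟩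
  calc inner ℂ (R a) b = inner ℂ (R a) (T ⟨R b, hd b⟩ - (z : ℂ) • R b) := by rw [hR]
    _ = inner ℂ (T ⟨R a, hd a⟩ - (z : ℂ) • R a) (R b) := by
      rw [inner_sub_left, inner_sub_right, inner_smul_left, inner_smul_right, Complex.conj_ofReal,
        h1]
    _ = inner ℂ a (R b) := by rw [hR]

/-- If every real `z < E₀` is in the resolvent set of the symmetric operator `T`, then `T ≥ E₀` as a
quadratic form: the resolvents at such points are self-adjoint with nonnegative spectrum. -/
lemma le_form_of_inResolventSet [CompleteSpace E] {T : E →ₗ.[ℂ] E} (hT : T.IsFormalAdjoint T)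
    {E₀ : ℝ} (h : ∀ z : ℝ, z < E₀ → InResolventSet T z) (x : T.domain) :
    E₀ * ‖(x : E)‖ ^ 2 ≤ (inner ℂ (T x) (x : E)).re := by
  suffices H : ∀ z : ℝ, z < E₀ → z * ‖(x : E)‖ ^ 2 ≤ (inner ℂ (T x) (x : E)).re by
    have hlim : Filter.Tendsto (fun z : ℝ => z * ‖(x : E)‖ ^ 2) (nhdsWithin E₀ (Set.Iio E₀))
        (nhds (E₀ * ‖(x : E)‖ ^ 2)) :=
      (continuous_id.mul continuous_const).continuousWithinAt.tendsto
    refine le_of_tendsto hlim ?_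
    filter_upwards [self_mem_nhdsWithin] with z hz using H z hz
  intro z hz
  obtain ⟨R, hR1, hR2⟩ := h z hz
  choose hd hR1 using hR1
  have hsa := inner_resolvent hT hd hR1
  have hRsa : IsSelfAdjoint R := by
    rw [ContinuousLinearMap.isSelfAdjoint_iff_isSymmetric]
    exact fun a b => hsa a b
  have hpos : 0 ≤ R := by
    rw [StarOrderedRing.nonneg_iff_spectrum_nonneg (R := ℝ) R hRsa]
    intro l hl
    by_contra! hneg
    apply hl
    -- `1/t - l = -l (t - 1/l) / t` with `t = T - z`, and `z + 1/l` is again below `E₀`.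
    have hz' : z + l⁻¹ < E₀ := by
      have := inv_lt_zero.2 hneg
      linarith
    obtain ⟨R', hR1', hR2'⟩ := h _ hz'
    choose hd' hR1' using hR1'
    have hlc : (l : ℂ) ≠ 0 := by exact_mod_cast hneg.ne
    -- the resolvent identity, in both orders
    have e1 : ∀ a, R' (R a) = (l : ℂ) • (R' a - R a) := by
      intro a
      have h1 : R' _ = R a := hR2' ⟨R a, hd a⟩
      have h2 := hR1 a
      have h3 : T ⟨R a, hd a⟩ - ((z + l⁻¹ : ℝ) : ℂ) • R a = a - (l : ℂ)⁻¹ • R a := by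
        rw [← sub_eq_zero, ← sub_eq_zero.2 h2]; push_cast; module
      rw [h3, map_sub, map_smul] at h1
      rw [sub_eq_iff_eq_add'.2 (sub_eq_iff_eq_add.1 h1), smul_smul, mul_inv_cancel₀ hlc, one_smul]
    have e2 : ∀ a, R (R' a) = (l : ℂ) • (R' a - R a) := by
      intro a
      have h1 : R _ = R' a := hR2 ⟨R' a, hd' a⟩
      have h2 := hR1' a
      have h3 : T ⟨R' a, hd' a⟩ - (z : ℂ) • R' a = a + (l : ℂ)⁻¹ • R' a := by
        rw [← sub_eq_zero, ← sub_eq_zero.2 h2]; push_cast; module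
      rw [h3, map_add, map_smul] at h1
      rw [← eq_sub_of_add_eq' h1, smul_smul, mul_inv_cancel₀ hlc, one_smul]
    have hL : ∀ v, (algebraMap ℝ (E →L[ℂ] E) l - R) v = (l : ℂ) • v - R v := by
      intro v
      rw [sub_apply, Algebra.algebraMap_eq_smul_one]
      rfl
    have hQ : ∀ v, ((l : ℂ)⁻¹ • (1 + (l : ℂ)⁻¹ • R')) v
        = (l : ℂ)⁻¹ • (v + (l : ℂ)⁻¹ • R' v) := fun v => rfl
    refine isUnit_iff_exists.2 ⟨(l : ℂ)⁻¹ • (1 + (l : ℂ)⁻¹ • R'), ?_, ?_⟩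
    · ext a
      rw [mul_apply_eq_comp, hL, hQ, map_smul, map_add, map_smul, e2, one_apply_eq_self]
      match_scalars <;> field_simp <;> ring
    · ext a
      rw [mul_apply_eq_comp, hL, hQ, map_sub, map_smul, e1, one_apply_eq_self]
      match_scalars <;> field_simp <;> ring
  rw [ContinuousLinearMap.nonneg_iff_isPositive] at hpos
  have h1 : 0 ≤ (inner ℂ (T x - (z : ℂ) • (x : E)) (R (T x - (z : ℂ) • (x : E)))).re :=
    hpos.re_inner_nonneg_right _
  rw [hR2, inner_sub_left, Complex.sub_re, re_inner_ofReal_smul_self] at h1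
  linarith

/-- A bounded perturbation of a symmetric operator `T` has no real spectrum far below that
of `T` (Neumann series). -/
lemma inResolventSet_addBounded [CompleteSpace E] {T : E →ₗ.[ℂ] E} (hT : T.IsFormalAdjoint T)
    {E₀ : ℝ} (h : ∀ z : ℝ, z < E₀ → InResolventSet T z) (B : E →L[ℂ] E) {z : ℝ}
    (hz : z < E₀ - ‖B‖) : InResolventSet (addBounded T B) z := by
  have hz0 : z < E₀ := hz.trans_le (sub_le_self _ (norm_nonneg B))
  obtain ⟨R, hR1, hR2⟩ := h z hz0
  choose hd hR1 using hR1
  have hRn : ‖R‖ ≤ (E₀ - z)⁻¹ := by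
    refine R.opNorm_le_bound (inv_nonneg.2 (sub_nonneg.2 hz0.le)) fun a => ?_
    have h1 := le_form_of_inResolventSet hT h ⟨R a, hd a⟩
    have h2 : (inner ℂ (T ⟨R a, hd a⟩ - (z : ℂ) • R a) (R a)).re
        = (inner ℂ (T ⟨R a, hd a⟩) (R a)).re - z * ‖R a‖ ^ 2 := by
      rw [inner_sub_left, Complex.sub_re, re_inner_ofReal_smul_self]
    rw [hR1] at h2
    have h3 : (inner ℂ a (R a)).re ≤ ‖a‖ * ‖R a‖ :=
      (Complex.re_le_norm _).trans (norm_inner_le_norm _ _)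
    have h4 : (E₀ - z) * ‖R a‖ ^ 2 ≤ ‖a‖ * ‖R a‖ := by
      simp only at h1
      nlinarith
    rw [inv_mul_eq_div, le_div_iff₀ (sub_pos.2 hz0)]
    rcases (norm_nonneg (R a)).eq_or_lt with h0 | h0
    · rw [← h0]; simp
    · nlinarith
  have hBR : ‖-(B * R)‖ < 1 := by
    rw [norm_neg]
    calc ‖B * R‖ ≤ ‖B‖ * ‖R‖ := norm_mul_le _ _
      _ ≤ ‖B‖ * (E₀ - z)⁻¹ := by gcongr
      _ < 1 := by
        rw [← div_eq_mul_inv, div_lt_one (sub_pos.2 hz0)]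
        linarith
  obtain ⟨u, hu⟩ := isUnit_one_sub_of_norm_lt_one hBR
  have hu' : ∀ a, (u : E →L[ℂ] E) a = a + B (R a) := by
    intro a
    rw [hu]
    simp
  have hui : ∀ a, (↑u⁻¹ : E →L[ℂ] E) a + B (R ((↑u⁻¹ : E →L[ℂ] E) a)) = a := by
    intro a
    rw [← hu', ← mul_apply_eq_comp, Units.mul_inv, one_apply_eq_self]
  refine ⟨R * (↑u⁻¹ : E →L[ℂ] E), fun y => ⟨hd _, ?_⟩, fun x => ?_⟩
  · change T ⟨R ((↑u⁻¹ : E →L[ℂ] E) y), hd _⟩ + B (R ((↑u⁻¹ : E →L[ℂ] E) y))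
      - (z : ℂ) • R ((↑u⁻¹ : E →L[ℂ] E) y) = y
    rw [add_sub_right_comm, hR1, hui]
  · change R ((↑u⁻¹ : E →L[ℂ] E) (T x + B x - (z : ℂ) • (x : E))) = x
    have h1 : T x + B x - (z : ℂ) • (x : E)
        = (u : E →L[ℂ] E) (T x - (z : ℂ) • (x : E)) := by
      rw [hu']
      have := hR2 x
      rw [show R (T x - (z : ℂ) • (x : E)) = x from this]
      abel
    rw [h1, ← mul_apply_eq_comp (↑u⁻¹ : E →L[ℂ] E), Units.inv_mul,
      one_apply_eq_self]
    exact hR2 x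

lemma inResolventSet_of_lt_infSpectrum {T : E →ₗ.[ℂ] E} {z : ℝ}
    (hz : (z : EReal) < infSpectrum T) : InResolventSet T z := by
  by_contra hz'
  exact hz.not_ge (sInf_le (Set.mem_image_of_mem _ hz'))

lemma bot_lt_infSpectrum_addBounded [CompleteSpace E] {T : E →ₗ.[ℂ] E}
    (hT : T.IsFormalAdjoint T) {E₀ : ℝ} (h : infSpectrum T = E₀) (B : E →L[ℂ] E) :
    ⊥ < infSpectrum (addBounded T B) := by
  refine (EReal.bot_lt_coe (E₀ - ‖B‖)).trans_le (le_sInf ?_)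
  rintro _ ⟨z, hz, rfl⟩
  by_contra! hlt
  refine hz (inResolventSet_addBounded hT (E₀ := E₀) (fun w hw => ?_) B
    (EReal.coe_lt_coe_iff.1 hlt))
  exact inResolventSet_of_lt_infSpectrum (by rw [h]; exact_mod_cast hw)

/-- A vector at which the form of a symmetric operator attains a lower bound of its spectrum is an
eigenvector. The range of a resolvent of `T` replaces the density of the domain. -/
lemma eq_smul_of_form_eq [CompleteSpace E] {T : E →ₗ.[ℂ] E} (hT : T.IsFormalAdjoint T)
    {E₀ : ℝ} (h : ∀ z : ℝ, z < E₀ → InResolventSet T z) (x : T.domain)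
    (hx : (inner ℂ (T x) (x : E)).re = E₀ * ‖(x : E)‖ ^ 2) : T x = (E₀ : ℂ) • (x : E) := by
  set q : T.domain → ℝ := fun y => (inner ℂ (T y - (E₀ : ℂ) • (y : E)) (y : E)).re with hq
  have hq0 : ∀ y, 0 ≤ q y := by
    intro y
    have := le_form_of_inResolventSet hT h y
    simp only [hq, inner_sub_left, Complex.sub_re, re_inner_ofReal_smul_self]
    linarith
  have hqx : q x = 0 := by
    simp only [hq, inner_sub_left, Complex.sub_re, re_inner_ofReal_smul_self]
    linarith
  set w : E := T x - (E₀ : ℂ) • (x : E) with hw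
  -- first variation of the form at its minimizer `x`
  have hperp : ∀ v : T.domain, (inner ℂ w (v : E)).re = 0 := by
    intro v
    have hexp : ∀ t : ℝ, q (x + (t : ℂ) • v) = 2 * t * (inner ℂ w (v : E)).re + t ^ 2 * q v := by
      intro t
      have e1 : (inner ℂ (T v) (x : E)).re = (inner ℂ (T x) (v : E)).re := by
        have := hT v x
        rw [this, ← inner_conj_symm, Complex.conj_re]
      have e2 : (inner ℂ (v : E) (x : E)).re = (inner ℂ (x : E) (v : E)).re := by
        rw [← inner_conj_symm, Complex.conj_re]
      have e3 : T (x + (t : ℂ) • v) - (E₀ : ℂ) • ((x + (t : ℂ) • v : T.domain) : E)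
          = w + (t : ℂ) • (T v - (E₀ : ℂ) • (v : E)) := by
        rw [T.map_add, T.map_smul, hw]
        simp only [Submodule.coe_add, Submodule.coe_smul]
        module
      have e4 : (inner ℂ (T v - (E₀ : ℂ) • (v : E)) (x : E)).re = (inner ℂ w (v : E)).re := by
        simp only [hw, inner_sub_left, Complex.sub_re, inner_smul_left, Complex.conj_ofReal,
          Complex.re_ofReal_mul, e1, e2]
      have e5 : (inner ℂ w (x : E)).re = 0 := hqx
      have e6 : q v = (inner ℂ (T v - (E₀ : ℂ) • (v : E)) (v : E)).re := rfl
      simp only [hq, e3]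
      simp only [Submodule.coe_add, Submodule.coe_smul, inner_add_left, inner_add_right,
        Complex.add_re, inner_smul_left, inner_smul_right, Complex.conj_ofReal,
        Complex.re_ofReal_mul, e4, e5]
      ring
    by_contra hne
    have h1 := hq0 v
    have h2 := hq0 (x + ((-(inner ℂ w (v : E)).re / (q v + 1) : ℝ) : ℂ) • v)
    rw [hexp] at h2
    have h3 : 0 < (inner ℂ w (v : E)).re ^ 2 := by positivity
    have h4 : 2 * (-(inner ℂ w (v : E)).re / (q v + 1)) * (inner ℂ w (v : E)).re
        + (-(inner ℂ w (v : E)).re / (q v + 1)) ^ 2 * q v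
        = -((inner ℂ w (v : E)).re ^ 2 * (q v + 2)) / (q v + 1) ^ 2 := by
      field_simp
      ring
    rw [h4, neg_div, Left.nonneg_neg_iff] at h2
    have h5 : 0 < (inner ℂ w (v : E)).re ^ 2 * (q v + 2) / (q v + 1) ^ 2 := by positivity
    linarith
  obtain ⟨R, hR1, hR2⟩ := h (E₀ - 1) (by linarith)
  choose hd hR1 using hR1
  -- `‖R w‖² = Re ⟨w, R (R w)⟩ = 0`
  have hRw : R w = 0 := by
    have h1 := hperp ⟨R (R w), hd _⟩
    rw [← inner_resolvent hT hd hR1] at h1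
    have h2 : ‖R w‖ ^ 2 = 0 := (inner_self_eq_norm_sq (𝕜 := ℂ) (R w)).symm.trans h1
    simpa using h2
  have hw0 : w = 0 := by
    rw [← hR1 w]
    have : (⟨R w, hd w⟩ : T.domain) = 0 := Subtype.ext hRw
    rw [this, T.map_zero, hRw, smul_zero, sub_zero]
  rwa [hw, sub_eq_zero] at hw0

/-- If an isometry `P` preserves the graph of `T` and anticommutes with the injective bounded
perturbation `B`, and `T` has a ground state, then `T + B` has strictly smaller ground state
energy. -/
lemma infSpectrum_addBounded_lt [CompleteSpace E] {T : E →ₗ.[ℂ] E} (hT : T.IsFormalAdjoint T)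
    {B : E →L[ℂ] E} (hB : ∀ x y, inner ℂ (B x) y = inner ℂ x (B y)) (hBinj : ∀ x, B x = 0 → x = 0)
    {P : E →L[ℂ] E} (hP : ∀ x y, inner ℂ (P x) (P y) = inner ℂ x y)
    (hPT : ∀ z ∈ T.graph, (P z.1, P z.2) ∈ T.graph) (hPB : ∀ x, B (P x) = -P (B x))
    (hgs : HasGroundState T) : infSpectrum (addBounded T B) < infSpectrum T := by
  obtain ⟨E₀, hE, x, hx0, hx⟩ := hgs
  rw [hE]
  by_contra! hle
  have hS := isFormalAdjoint_addBounded hT hB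
  have hres : ∀ z : ℝ, z < E₀ → InResolventSet (addBounded T B) z := fun z hz =>
    inResolventSet_of_lt_infSpectrum (lt_of_lt_of_le (by exact_mod_cast hz) hle)
  have hform : ∀ y : T.domain, T y = (E₀ : ℂ) • (y : E) →
      (inner ℂ (addBounded T B y) (y : E)).re
        = E₀ * ‖(y : E)‖ ^ 2 + (inner ℂ (B y) (y : E)).re := by
    intro y hy
    have h1 : addBounded T B y = T y + B y := rfl
    rw [h1, hy, inner_add_left, Complex.add_re, re_inner_ofReal_smul_self]
  have hnn : ∀ y : T.domain, T y = (E₀ : ℂ) • (y : E) → 0 ≤ (inner ℂ (B y) (y : E)).re := by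
    intro y hy
    have h1 := le_form_of_inResolventSet hS hres y
    rw [hform y hy] at h1
    linarith
  obtain ⟨y, hy, hy'⟩ := T.mem_graph_iff.1 (hPT _ (T.mem_graph x))
  simp only at hy hy'
  have h1 := hnn x hx
  have h2 := hnn y (by rw [hy', hy, hx, map_smul])
  rw [hy, hPB, inner_neg_left, hP, Complex.neg_re] at h2
  have h3 := eq_smul_of_form_eq hS hres x (by rw [hform x hx]; linarith)
  have h4 : T x + B x = (E₀ : ℂ) • (x : E) := h3
  rw [hx, add_eq_left] at h4
  exact hx0 (hBinj _ h4)

end Operators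

/-! ### Graphs of sums and matrix combinations of operators -/

section Graphs

variable {E : Type*} [NormedAddCommGroup E] [InnerProductSpace ℂ E] {S T : E →ₗ.[ℂ] E}

lemma mem_graph_add {z : E × E} :
    z ∈ (S + T).graph ↔ ∃ a b, (z.1, a) ∈ S.graph ∧ (z.1, b) ∈ T.graph ∧ z.2 = a + b := by
  simp only [LinearPMap.mem_graph_iff]
  constructor
  · rintro ⟨y, hy, hy'⟩
    exact ⟨_, _, ⟨⟨y, y.2.1⟩, hy, rfl⟩, ⟨⟨y, y.2.2⟩, hy, rfl⟩, by rw [← hy']; rfl⟩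
  · rintro ⟨_, _, ⟨y, hy, rfl⟩, ⟨w, hw, rfl⟩, h⟩
    have hyw : (w : E) = y := hw.trans hy.symm
    refine ⟨⟨y, y.2, hyw ▸ w.2⟩, hy, ?_⟩
    rw [h, LinearPMap.add_apply]
    congr 2
    exact Subtype.ext hyw.symm

lemma mem_graph_neg {z : E × E} : z ∈ (-T).graph ↔ (z.1, -z.2) ∈ T.graph := by
  simp only [LinearPMap.mem_graph_iff]
  constructor
  · rintro ⟨y, hy, hy'⟩
    exact ⟨⟨y, y.2⟩, hy, by rw [← hy', LinearPMap.neg_apply, neg_neg]; rfl⟩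
  · rintro ⟨y, hy, hy'⟩
    exact ⟨⟨y, y.2⟩, hy, (congrArg Neg.neg hy').trans (neg_neg _)⟩

lemma mem_graph_sub {z : E × E} :
    z ∈ (S - T).graph ↔ ∃ a b, (z.1, a) ∈ S.graph ∧ (z.1, b) ∈ T.graph ∧ z.2 = a - b := by
  rw [sub_eq_add_neg, mem_graph_add]
  constructor
  · rintro ⟨a, b, ha, hb, h⟩
    exact ⟨a, -b, ha, mem_graph_neg.1 hb, by rw [h, sub_neg_eq_add]⟩
  · rintro ⟨a, b, ha, hb, h⟩
    exact ⟨a, -b, ha, mem_graph_neg.2 (by rwa [neg_neg]), by rw [h, sub_eq_add_neg]⟩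

lemma mem_graph_smul {c : ℂ} {z : E × E} :
    z ∈ (c • T).graph ↔ ∃ a, (z.1, a) ∈ T.graph ∧ z.2 = c • a := by
  simp only [LinearPMap.mem_graph_iff]
  constructor
  · rintro ⟨y, hy, hy'⟩
    exact ⟨_, ⟨⟨y, y.2⟩, hy, rfl⟩, by rw [← hy']; rfl⟩
  · rintro ⟨_, ⟨y, hy, rfl⟩, h⟩
    exact ⟨⟨y, y.2⟩, hy, by rw [h]; rfl⟩

lemma isFormalAdjoint_add (hS : S.IsFormalAdjoint S) (hT : T.IsFormalAdjoint T) :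
    (S + T).IsFormalAdjoint (S + T) := by
  rw [isFormalAdjoint_iff_graph] at *
  intro z hz w hw
  obtain ⟨a, b, ha, hb, h⟩ := mem_graph_add.1 hz
  obtain ⟨a', b', ha', hb', h'⟩ := mem_graph_add.1 hw
  rw [h, h', inner_add_left, inner_add_right]
  exact congrArg₂ (· + ·) (hS _ ha _ ha') (hT _ hb _ hb')

lemma isFormalAdjoint_smul {c : ℂ} (hc : starRingEnd ℂ c = c) (hT : T.IsFormalAdjoint T) :
    (c • T).IsFormalAdjoint (c • T) := by
  rw [isFormalAdjoint_iff_graph] at *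
  intro z hz w hw
  obtain ⟨a, ha, h⟩ := mem_graph_smul.1 hz
  obtain ⟨b, hb, h'⟩ := mem_graph_smul.1 hw
  rw [h, h', inner_smul_left, inner_smul_right, hc]
  exact congrArg (c * ·) (hT _ ha _ hb)

lemma isFormalAdjoint_sub (hS : S.IsFormalAdjoint S) (hT : T.IsFormalAdjoint T) :
    (S - T).IsFormalAdjoint (S - T) := by
  rw [isFormalAdjoint_iff_graph] at *
  intro z hz w hw
  obtain ⟨a, b, ha, hb, h⟩ := mem_graph_sub.1 hz
  obtain ⟨a', b', ha', hb', h'⟩ := mem_graph_sub.1 hw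
  rw [h, h', inner_sub_left, inner_sub_right]
  exact congrArg₂ (· - ·) (hS _ ha _ ha') (hT _ hb _ hb')

lemma isFormalAdjoint_zero : (0 : E →ₗ.[ℂ] E).IsFormalAdjoint 0 := by
  intro x y
  rw [LinearPMap.zero_apply, LinearPMap.zero_apply, inner_zero_left, inner_zero_right]

lemma isFormalAdjoint_sum {ι : Type*} (s : Finset ι) {T : ι → E →ₗ.[ℂ] E}
    (hT : ∀ i, (T i).IsFormalAdjoint (T i)) :
    (∑ i ∈ s, T i).IsFormalAdjoint (∑ i ∈ s, T i) :=
  Finset.sum_induction T (fun A => A.IsFormalAdjoint A) (fun _ _ => isFormalAdjoint_add)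
    isFormalAdjoint_zero fun i _ => hT i

/-- `T P = c P T` on the domain of `T`, which `P` maps into itself. -/
def Intertwines (P : E →L[ℂ] E) (c : ℂ) (T : E →ₗ.[ℂ] E) : Prop :=
  ∀ z ∈ T.graph, (P z.1, c • P z.2) ∈ T.graph

variable {P : E →L[ℂ] E} {c : ℂ}

lemma Intertwines.add (hS : Intertwines P c S) (hT : Intertwines P c T) :
    Intertwines P c (S + T) := by
  intro z hz
  obtain ⟨a, b, ha, hb, h⟩ := mem_graph_add.1 hz
  exact mem_graph_add.2 ⟨_, _, hS (z.1, a) ha, hT (z.1, b) hb, by simp [h]⟩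

lemma Intertwines.sub (hS : Intertwines P c S) (hT : Intertwines P c T) :
    Intertwines P c (S - T) := by
  intro z hz
  obtain ⟨a, b, ha, hb, h⟩ := mem_graph_sub.1 hz
  exact mem_graph_sub.2 ⟨_, _, hS (z.1, a) ha, hT (z.1, b) hb, by simp [h, smul_sub]⟩

lemma Intertwines.smul (d : ℂ) (hT : Intertwines P c T) : Intertwines P c (d • T) := by
  intro z hz
  obtain ⟨a, ha, h⟩ := mem_graph_smul.1 hz
  exact mem_graph_smul.2 ⟨_, hT (z.1, a) ha, by simp [h, smul_comm c d]⟩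

lemma intertwines_zero : Intertwines P c (0 : E →ₗ.[ℂ] E) := by
  intro z hz
  obtain ⟨y, hy, hy'⟩ := LinearPMap.mem_graph_iff _ |>.1 hz
  rw [LinearPMap.zero_apply] at hy'
  exact (LinearPMap.mem_graph_iff _).2 ⟨⟨P z.1, Submodule.mem_top⟩, rfl, by simp [← hy']⟩

lemma Intertwines.sum {ι : Type*} (s : Finset ι) {T : ι → E →ₗ.[ℂ] E}
    (hT : ∀ i, Intertwines P c (T i)) : Intertwines P c (∑ i ∈ s, T i) :=
  Finset.sum_induction T (Intertwines P c) (fun _ _ => Intertwines.add) intertwines_zero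
    fun i _ => hT i

lemma Intertwines.closure (hT : Intertwines P c T) : Intertwines P c T.closure :=
  closure_graph_mapsTo
    ((P.comp (ContinuousLinearMap.fst ℂ E E)).prod (c • P.comp (ContinuousLinearMap.snd ℂ E E))) hT

end Graphs

/-! ### Matrices of operators on the fibre space -/

section Fibre

/-- The bounded operator `B ⊗ L` on the fibre space. -/
def matOp (B : Matrix (Fin 4) (Fin 4) ℂ) (L : Fock →L[ℂ] Fock) : Fibre →L[ℂ] Fibre :=
  ((PiLp.continuousLinearEquiv 2 ℂ fun _ : Fin 4 => Fock).symm : _ →L[ℂ] Fibre).comp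
    (ContinuousLinearMap.pi fun i => ∑ j, B i j • L.comp (PiLp.proj 2 (fun _ : Fin 4 => Fock) j))

lemma matOp_apply (B : Matrix (Fin 4) (Fin 4) ℂ) (L : Fock →L[ℂ] Fock) (Ψ : Fibre) (i : Fin 4) :
    matOp B L Ψ i = ∑ j, B i j • L (Ψ j) := by
  simp [matOp]

lemma matOp_add (B C : Matrix (Fin 4) (Fin 4) ℂ) (L : Fock →L[ℂ] Fock) :
    matOp (B + C) L = matOp B L + matOp C L := by
  ext1 Ψ
  ext1 i
  simp [matOp_apply, add_smul, Finset.sum_add_distrib]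

lemma matOp_mul (B C : Matrix (Fin 4) (Fin 4) ℂ) (L K : Fock →L[ℂ] Fock) (Ψ : Fibre) :
    matOp B L (matOp C K Ψ) = matOp (B * C) (L.comp K) Ψ := by
  ext1 i
  simp only [matOp_apply, map_sum, map_smul, Matrix.mul_apply, Finset.sum_smul, Finset.smul_sum,
    smul_smul, ContinuousLinearMap.comp_apply]
  exact Finset.sum_comm

/-- `⟨B x, C y⟩ = ⟨x, B* C y⟩` for matrices acting on the spinor index. -/
lemma inner_sum_smul (B C : Matrix (Fin 4) (Fin 4) ℂ) (x y : Fin 4 → Fock) :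
    ∑ i, inner ℂ (∑ j, B i j • x j) (∑ k, C i k • y k)
      = ∑ j, ∑ k, (B.conjTranspose * C) j k * inner ℂ (x j) (y k) := by
  simp only [sum_inner, inner_sum, inner_smul_left, inner_smul_right, Matrix.mul_apply,
    Matrix.conjTranspose_apply, Finset.sum_mul, Finset.mul_sum, starRingEnd_apply]
  conv_lhs => enter [2, i]; rw [Finset.sum_comm]
  rw [Finset.sum_comm]
  refine Finset.sum_congr rfl fun j _ => ?_
  rw [Finset.sum_comm]
  exact Finset.sum_congr rfl fun k _ => Finset.sum_congr rfl fun i _ => by ring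

lemma sum_one_smul (y : Fin 4 → Fock) (i : Fin 4) :
    ∑ k, (1 : Matrix (Fin 4) (Fin 4) ℂ) i k • y k = y i := by
  simp [Matrix.one_apply]

lemma inner_matOp_of_hermitian {B : Matrix (Fin 4) (Fin 4) ℂ} (hB : B.IsHermitian)
    (Ψ Φ : Fibre) : inner ℂ (matOp B 1 Ψ) Φ = inner ℂ Ψ (matOp B 1 Φ) := by
  have h1 := inner_sum_smul B 1 Ψ Φ
  have h2 := inner_sum_smul 1 B Ψ Φ
  simp only [sum_one_smul] at h1 h2
  rw [hB.eq, mul_one] at h1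
  rw [Matrix.conjTranspose_one, one_mul] at h2
  simp only [PiLp.inner_apply, matOp_apply, one_apply_eq_self]
  rw [h1, h2]

lemma inner_matOp_matOp {B : Matrix (Fin 4) (Fin 4) ℂ} (hB : B.conjTranspose * B = 1)
    {L : Fock →L[ℂ] Fock} (hL : ∀ x y, inner ℂ (L x) (L y) = inner ℂ x y) (Ψ Φ : Fibre) :
    inner ℂ (matOp B L Ψ) (matOp B L Φ) = inner ℂ Ψ Φ := by
  simp only [PiLp.inner_apply, matOp_apply]
  rw [inner_sum_smul, hB]
  simp [Matrix.one_apply, hL]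

lemma mem_graph_matTensor {B : Matrix (Fin 4) (Fin 4) ℂ} {T : Fock →ₗ.[ℂ] Fock}
    {z : Fibre × Fibre} :
    z ∈ (matTensor B T).graph ↔
      ∃ y : Fin 4 → Fock, (∀ i, (z.1 i, y i) ∈ T.graph) ∧ ∀ i, z.2 i = ∑ j, B i j • y j := by
  constructor
  · intro hz
    obtain ⟨w, hw, hw'⟩ := (LinearPMap.mem_graph_iff _).1 hz
    refine ⟨fun i => T ⟨w.1 i, w.2 i⟩, fun i => ?_, fun i => ?_⟩
    · rw [← hw]
      exact T.mem_graph ⟨w.1 i, w.2 i⟩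
    · rw [← hw']
      rfl
  · rintro ⟨y, hy, hy'⟩
    have hd : ∀ i, z.1 i ∈ T.domain := fun i => LinearPMap.mem_domain_of_mem_graph (hy i)
    refine (LinearPMap.mem_graph_iff _).2 ⟨⟨z.1, hd⟩, rfl, ?_⟩
    ext1 i
    rw [hy' i]
    change ∑ j, B i j • T ⟨z.1 j, hd j⟩ = _
    refine Finset.sum_congr rfl fun j _ => ?_
    rw [(LinearPMap.image_iff (hd j)).2 (hy j)]

lemma isFormalAdjoint_matTensor {B : Matrix (Fin 4) (Fin 4) ℂ} (hB : B.IsHermitian)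
    {T : Fock →ₗ.[ℂ] Fock} (hT : T.IsFormalAdjoint T) :
    (matTensor B T).IsFormalAdjoint (matTensor B T) := by
  rw [isFormalAdjoint_iff_graph] at *
  intro z hz w hw
  obtain ⟨y, hy, hy'⟩ := mem_graph_matTensor.1 hz
  obtain ⟨x, hx, hx'⟩ := mem_graph_matTensor.1 hw
  have h1 := inner_sum_smul B 1 y w.1
  have h2 := inner_sum_smul 1 B z.1 x
  simp only [sum_one_smul] at h1 h2
  rw [hB.eq, mul_one] at h1
  rw [Matrix.conjTranspose_one, one_mul] at h2
  simp only [PiLp.inner_apply, hy', hx']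
  rw [h1, h2]
  exact Finset.sum_congr rfl fun j _ => Finset.sum_congr rfl fun k _ =>
    congrArg (_ * ·) (hT (z.1 j, y j) (hy j) (w.1 k, x k) (hx k))

lemma intertwines_matTensor {B C : Matrix (Fin 4) (Fin 4) ℂ} {T : Fock →ₗ.[ℂ] Fock}
    {L : Fock →L[ℂ] Fock} {c : ℂ} (hT : Intertwines L c T) (hBC : C * B = c • (B * C)) :
    Intertwines (matOp C L) 1 (matTensor B T) := by
  intro z hz
  obtain ⟨y, hy, hy'⟩ := mem_graph_matTensor.1 hz
  refine mem_graph_matTensor.2 ⟨fun i => ∑ k, C i k • c • L (y k), fun i => ?_, fun i => ?_⟩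
  · simp only [matOp_apply]
    have h1 : ∑ k, C i k • ((L (z.1 k), c • L (y k)) : Fock × Fock) ∈ T.graph :=
      Submodule.sum_mem _ fun k _ => T.graph.smul_mem _ (hT (z.1 k, y k) (hy k))
    rwa [show ∑ k, C i k • ((L (z.1 k), c • L (y k)) : Fock × Fock)
      = (∑ k, C i k • L (z.1 k), ∑ k, C i k • c • L (y k)) from
      Prod.ext (by simp [Prod.fst_sum]) (by simp [Prod.snd_sum])] at h1
  · have h1 : ∀ k, (C * B) i k = c * (B * C) i k := fun k => by rw [hBC]; rfl
    simp only [one_smul, matOp_apply, hy', map_sum, map_smul, Finset.smul_sum, smul_smul]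
    rw [Finset.sum_comm]
    conv_rhs => rw [Finset.sum_comm]
    refine Finset.sum_congr rfl fun k _ => ?_
    have h2 := congrArg (· • L (y k)) (h1 k)
    simp only [Matrix.mul_apply, Finset.mul_sum, Finset.sum_smul] at h2
    rw [h2]
    refine Finset.sum_congr rfl fun j _ => ?_
    congr 1
    ring

lemma mem_graph_matTensor_id {B : Matrix (Fin 4) (Fin 4) ℂ} {z : Fibre × Fibre} :
    z ∈ (matTensor B (LinearMap.id.toPMap ⊤)).graph ↔ z.2 = matOp B 1 z.1 := by
  rw [mem_graph_matTensor]
  have hid : ∀ a b : Fock, (a, b) ∈ ((LinearMap.id : Fock →ₗ[ℂ] Fock).toPMap ⊤).graph ↔ a = b := by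
    intro a b
    rw [LinearPMap.mem_graph_iff]
    constructor
    · rintro ⟨y, hy, hy'⟩
      exact hy.symm.trans hy'
    · rintro rfl
      exact ⟨⟨a, Submodule.mem_top⟩, rfl, rfl⟩
  constructor
  · rintro ⟨y, hy, hy'⟩
    ext1 i
    rw [hy', matOp_apply]
    exact Finset.sum_congr rfl fun j _ => by rw [← (hid _ _).1 (hy j)]; rfl
  · intro h
    exact ⟨z.1, fun i => (hid _ _).2 rfl, fun i => by rw [h, matOp_apply]; rfl⟩

/-! ### Dirac matrices and the dependence of the Hamiltonian on the total momentum -/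

variable {α : Fin 3 → Matrix (Fin 4) (Fin 4) ℂ} {β : Matrix (Fin 4) (Fin 4) ℂ}

lemma IsDirac.beta_mul_alpha (hD : IsDirac α β) (j : Fin 3) :
    β * α j = (-1 : ℂ) • (α j * β) := by
  rw [neg_one_smul]
  exact eq_neg_of_add_eq_zero_right (hD.alpha_beta j)

lemma IsDirac.hermitian_sum (hD : IsDirac α β) (p : R3) :
    (∑ j, (p j : ℂ) • α j).IsHermitian := by
  rw [Matrix.IsHermitian, Matrix.conjTranspose_sum]
  refine Finset.sum_congr rfl fun j _ => ?_
  rw [Matrix.conjTranspose_smul, (hD.hermitian_alpha j).eq, ← starRingEnd_apply,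
    Complex.conj_ofReal]

lemma IsDirac.sq_sum (hD : IsDirac α β) (p : R3) :
    (∑ j, (p j : ℂ) • α j) * (∑ j, (p j : ℂ) • α j) = ((‖p‖ ^ 2 : ℝ) : ℂ) • 1 := by
  have h : (2 : ℂ) • ((∑ j, (p j : ℂ) • α j) * (∑ j, (p j : ℂ) • α j))
      = (2 : ℂ) • (((‖p‖ ^ 2 : ℝ) : ℂ) • (1 : Matrix (Fin 4) (Fin 4) ℂ)) := by
    calc (2 : ℂ) • ((∑ j, (p j : ℂ) • α j) * (∑ j, (p j : ℂ) • α j))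
        = ∑ j, ∑ l, ((p j : ℂ) * (p l : ℂ)) • (α j * α l + α l * α j) := by
          simp only [smul_add, Finset.sum_add_distrib, two_smul]
          simp only [Finset.sum_mul_sum, smul_mul_smul_comm]
          congr 1
          rw [Finset.sum_comm]
          exact Finset.sum_congr rfl fun j _ => Finset.sum_congr rfl fun l _ => by
            rw [mul_comm (p l : ℂ)]
      _ = _ := by
          simp only [hD.alpha_alpha, smul_ite, smul_zero, Finset.sum_ite_eq, Finset.mem_univ,
            if_true]
          rw [← Finset.sum_smul, EuclideanSpace.real_norm_sq_eq, smul_smul, mul_comm, ← smul_smul]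
          push_cast
          rw [show (2 : Matrix (Fin 4) (Fin 4) ℂ) = (2 : ℂ) • 1 by
            rw [two_smul, one_add_one_eq_two]]
          simp only [pow_two]
  exact smul_right_injective _ (two_ne_zero (α := ℂ)) h

lemma IsDirac.beta_mul_sum (hD : IsDirac α β) (p : R3) :
    β * (∑ j, (p j : ℂ) • α j) = -((∑ j, (p j : ℂ) • α j) * β) := by
  rw [Finset.mul_sum, Finset.sum_mul, ← Finset.sum_neg_distrib]
  refine Finset.sum_congr rfl fun j _ => ?_
  rw [mul_smul_comm, smul_mul_assoc, hD.beta_mul_alpha, neg_one_smul, smul_neg]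

variable (M q m : ℝ) (ρ : R3 → ℂ) (e : Fin 2 → R3 → R3)

lemma hamiltonian_eq_addBounded (p : R3) :
    hamiltonian α β M q m ρ e p
      = addBounded (hamiltonian α β M q m ρ e 0) (matOp (∑ j, (p j : ℂ) • α j) 1) := by
  apply LinearPMap.eq_of_eq_graph
  ext z
  rw [mem_graph_addBounded]
  unfold hamiltonian
  have h0 : ∑ j, (((0 : R3) j : ℝ) : ℂ) • α j = 0 := by simp
  simp only [mem_graph_sub, mem_graph_add, mem_graph_matTensor_id, h0, zero_add, matOp_add,
    add_apply]
  constructor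
  · rintro ⟨a, b, ⟨a', b', ⟨c, d, hc, hd, h⟩, hb', h'⟩, hb, h''⟩
    exact ⟨_, b, ⟨_, b', ⟨_, d, rfl, hd, rfl⟩, hb', rfl⟩, hb, by rw [h'', h', h, hc]; abel⟩
  · rintro ⟨a, b, ⟨a', b', ⟨c, d, hc, hd, h⟩, hb', h'⟩, hb, h''⟩
    exact ⟨_, b, ⟨_, b', ⟨_, d, rfl, hd, rfl⟩, hb', rfl⟩, hb, by
      rw [sub_eq_iff_eq_add.1 h'', h', h, hc]; abel⟩

lemma hamiltonian_closure (p : R3) :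
    (hamiltonian α β M q m ρ e p).closure
      = addBounded (hamiltonian α β M q m ρ e 0).closure (matOp (∑ j, (p j : ℂ) • α j) 1) := by
  rw [hamiltonian_eq_addBounded, closure_addBounded]

variable {M q m ρ e}

lemma isFormalAdjoint_hamiltonian (hD : IsDirac α β)
    (hΓ : ∀ h, (dGamma h).IsFormalAdjoint (dGamma h))
    (hA : ∀ j, (vectorPotential ρ e j).IsFormalAdjoint (vectorPotential ρ e j)) (p : R3) :
    (hamiltonian α β M q m ρ e p).IsFormalAdjoint (hamiltonian α β M q m ρ e p) := by
  refine isFormalAdjoint_sub (isFormalAdjoint_sub (isFormalAdjoint_add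
    (isFormalAdjoint_matTensor ?_ fun _ _ => rfl)
    (isFormalAdjoint_matTensor Matrix.isHermitian_one (hΓ _)))
    (isFormalAdjoint_sum _ fun j => isFormalAdjoint_matTensor (hD.hermitian_alpha j) (hΓ _)))
    (isFormalAdjoint_smul (Complex.conj_ofReal q)
      (isFormalAdjoint_sum _ fun j => isFormalAdjoint_matTensor (hD.hermitian_alpha j) (hA j)))
  refine (hD.hermitian_sum p).add ?_
  rw [Matrix.IsHermitian, Matrix.conjTranspose_smul, hD.hermitian_beta.eq, ← starRingEnd_apply,
    Complex.conj_ofReal]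

/-- Parity invariance of the Hamiltonian at total momentum `0`: if `Γ` reverses the field momentum
and the vector potential, then `β ⊗ Γ` commutes with `H_m(0)`, since `β` anticommutes with `α`. -/
lemma intertwines_hamiltonian (hD : IsDirac α β) {Γ : Fock →L[ℂ] Fock}
    (hω : Intertwines Γ 1 (dGamma (dispersion m)))
    (hk : ∀ j, Intertwines Γ (-1) (dGamma fun k => k j))
    (hA : ∀ j, Intertwines Γ (-1) (vectorPotential ρ e j)) :
    Intertwines (matOp β Γ) 1 (hamiltonian α β M q m ρ e 0) := by
  have h1 : Intertwines Γ 1 ((LinearMap.id : Fock →ₗ[ℂ] Fock).toPMap ⊤) := by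
    intro z hz
    obtain ⟨y, hy, hy'⟩ := (LinearPMap.mem_graph_iff _).1 hz
    have : z.1 = z.2 := hy.symm.trans hy'
    exact (LinearPMap.mem_graph_iff _).2
      ⟨⟨Γ z.1, Submodule.mem_top⟩, rfl, by rw [one_smul, ← this]; rfl⟩
  refine (((intertwines_matTensor h1 ?_).add (intertwines_matTensor hω ?_)).sub
    (Intertwines.sum _ fun j => intertwines_matTensor (hk j) (hD.beta_mul_alpha j))).sub
    ((Intertwines.sum _ fun j => intertwines_matTensor (hA j) (hD.beta_mul_alpha j)).smul _)
  · simp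
  · simp

/-- The energy inequality, given a parity transformation `Γ` of the photon field. -/
lemma energy_lt_of_parity [CompleteSpace Fock] (hD : IsDirac α β)
    (hsym : ∀ h, (dGamma h).IsFormalAdjoint (dGamma h))
    (hsymA : ∀ j, (vectorPotential ρ e j).IsFormalAdjoint (vectorPotential ρ e j))
    {Γ : Fock →L[ℂ] Fock} (hΓ : ∀ x y, inner ℂ (Γ x) (Γ y) = inner ℂ x y)
    (hω : Intertwines Γ 1 (dGamma (dispersion m)))
    (hk : ∀ j, Intertwines Γ (-1) (dGamma fun k => k j))
    (hA : ∀ j, Intertwines Γ (-1) (vectorPotential ρ e j))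
    (hgs : HasGroundState (hamiltonian α β M q m ρ e 0).closure) {p : R3} (hp : p ≠ 0) :
    ⊥ < energy α β M q m ρ e p ∧ energy α β M q m ρ e p < energy α β M q m ρ e 0 := by
  have hT := isFormalAdjoint_closure
    (isFormalAdjoint_hamiltonian (M := M) (q := q) (m := m) hD hsym hsymA 0)
  have hββ : β.conjTranspose * β = 1 := by rw [hD.hermitian_beta.eq, hD.beta_sq]
  unfold energy
  rw [hamiltonian_closure M q m ρ e p]
  refine ⟨?_, ?_⟩
  · obtain ⟨E₀, hE, -⟩ := id hgs
    exact bot_lt_infSpectrum_addBounded hT hE _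
  · refine infSpectrum_addBounded_lt hT (inner_matOp_of_hermitian (hD.hermitian_sum p)) ?_
      (P := matOp β Γ) (inner_matOp_matOp hββ hΓ) ?_ ?_ hgs
    · intro x hx
      have h1 : matOp (∑ j, (p j : ℂ) • α j) 1 (matOp (∑ j, (p j : ℂ) • α j) 1 x)
          = ((‖p‖ ^ 2 : ℝ) : ℂ) • x := by
        rw [matOp_mul, hD.sq_sum]
        ext1 i
        simp [matOp_apply, Matrix.one_apply, Matrix.smul_apply]
      rw [hx, map_zero] at h1
      refine (smul_eq_zero.1 h1.symm).resolve_left ?_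
      simpa using hp
    · intro z hz
      simpa using (intertwines_hamiltonian (M := M) (q := q) hD hω hk hA).closure z hz
    · intro x
      rw [matOp_mul, matOp_mul, hD.beta_mul_sum]
      ext1 i
      simp [matOp_apply, Matrix.neg_apply]

end Fibre

/-! ### Integration over finitely many copies of a measure space -/

section ProdCount

variable {K I : Type*} [MeasurableSpace K] {ν : Measure K} [Fintype I] [MeasurableSpace I]

lemma ae_prod_count_iff {s : K × I → Prop} :
    (∀ᵐ z ∂ν.prod Measure.count, s z) ↔ ∀ᵐ k ∂ν, ∀ i, s (k, i) := by
  constructor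
  · intro h
    filter_upwards [Measure.ae_ae_of_ae_prod h] with k hk i
    rw [ae_iff, Measure.count_eq_zero_iff] at hk
    by_contra hi
    exact (hk ▸ hi : i ∈ (∅ : Set I))
  · intro h
    filter_upwards [Measure.quasiMeasurePreserving_fst.ae h] with z hz using hz z.2

lemma aestronglyMeasurable_prod_count [MeasurableSingletonClass I] {F : K × I → ℂ}
    (h : ∀ i, AEStronglyMeasurable (fun k => F (k, i)) ν) :
    AEStronglyMeasurable F (ν.prod Measure.count) := by
  refine ⟨fun z => (h z.2).mk _ z.1, ?_, ?_⟩
  · exact (measurable_from_prod_countable_left fun i =>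
      (h i).stronglyMeasurable_mk.measurable).stronglyMeasurable
  · exact ae_prod_count_iff.2 (ae_all_iff.2 fun i => (h i).ae_eq_mk)

lemma quasiMeasurePreserving_prodMk_count (i : I) :
    Measure.QuasiMeasurePreserving (fun k : K => (k, i)) ν (ν.prod Measure.count) := by
  refine ⟨by fun_prop, Measure.AbsolutelyContinuous.mk fun s hs h0 => ?_⟩
  rw [Measure.map_apply (by fun_prop) hs]
  have h1 : ∀ᵐ z ∂ν.prod Measure.count, z ∉ s := measure_eq_zero_iff_ae_notMem.1 h0
  exact measure_eq_zero_iff_ae_notMem.2 ((ae_all_iff.1 (ae_prod_count_iff.1 h1)) i)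

variable [SigmaFinite ν] [MeasurableSingletonClass I]

lemma memLp_prod_count_iff {F : K × I → ℂ} :
    MemLp F 2 (ν.prod Measure.count) ↔ ∀ i, MemLp (fun k => F (k, i)) 2 ν := by
  have hm : AEStronglyMeasurable F (ν.prod Measure.count) →
      ∫⁻ z, ‖F z‖ₑ ^ (2 : ℝ) ∂ν.prod Measure.count = ∑ i, ∫⁻ k, ‖F (k, i)‖ₑ ^ (2 : ℝ) ∂ν := by
    intro h
    rw [lintegral_prod_symm _ (h.enorm.pow_const _), lintegral_count, tsum_fintype]
  constructor
  · intro h i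
    have hi : AEStronglyMeasurable (fun k => F (k, i)) ν :=
      h.1.comp_quasiMeasurePreserving (quasiMeasurePreserving_prodMk_count i)
    refine ⟨hi, ?_⟩
    have h2 := h.2
    rw [eLpNorm_lt_top_iff_lintegral_rpow_enorm_lt_top two_ne_zero ENNReal.ofNat_ne_top] at h2 ⊢
    simp only [ENNReal.toReal_ofNat] at h2 ⊢
    rw [hm h.1, ENNReal.sum_lt_top] at h2
    exact h2 i (Finset.mem_univ i)
  · intro h
    have h1 := aestronglyMeasurable_prod_count fun i => (h i).1
    refine ⟨h1, ?_⟩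
    rw [eLpNorm_lt_top_iff_lintegral_rpow_enorm_lt_top two_ne_zero ENNReal.ofNat_ne_top]
    simp only [ENNReal.toReal_ofNat]
    rw [hm h1, ENNReal.sum_lt_top]
    intro i _
    have h2 := (h i).2
    rw [eLpNorm_lt_top_iff_lintegral_rpow_enorm_lt_top two_ne_zero ENNReal.ofNat_ne_top] at h2
    simpa using h2

lemma integrable_conj_mul {X : Type*} [MeasurableSpace X] {μ : Measure X} {φ ψ : X → ℂ}
    (hφ : MemLp φ 2 μ) (hψ : MemLp ψ 2 μ) :
    Integrable (fun x => starRingEnd ℂ (φ x) * ψ x) μ :=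
  hφ.star.integrable_mul hψ

lemma integral_prod_count {F : K × I → ℂ} (hF : Integrable F (ν.prod Measure.count)) :
    ∫ z, F z ∂ν.prod Measure.count = ∫ k, ∑ i, F (k, i) ∂ν := by
  rw [integral_prod _ hF]
  congr 1
  ext k
  rw [integral_fintype .of_finite]
  simp

end ProdCount

/-! ### Fibrewise unitary transformations combined with a reflection -/

section Reflection

variable {K I : Type*} [MeasurableSpace K] [Fintype I] [DecidableEq I]

section
variable {K I : Type*} [MeasurableSpace K] {ν : Measure K} [MeasurableSpace I] [Fintype I]
  [AddCommGroup K] [MeasurableNeg K] [ν.IsNegInvariant]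

lemma ae_reflect {s : K × I → Prop} (h : ∀ᵐ z ∂ν.prod (Measure.count : Measure I), s z) :
    ∀ᵐ z ∂ν.prod (Measure.count : Measure I), ∀ b, s (-z.1, b) := by
  have h1 : ∀ᵐ k ∂ν, ∀ b, s (-k, b) :=
    (Measure.measurePreserving_neg ν).quasiMeasurePreserving.ae (ae_prod_count_iff.1 h)
  filter_upwards [Measure.quasiMeasurePreserving_fst.ae h1] with z hz using hz

end

/-- A measurable family `k ↦ W k` of unitary matrices. As they are square, `W* W = 1` suffices. -/
structure IsUnitaryFamily (W : K → I → I → ℂ) : Prop where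
  measurable : ∀ a b, Measurable fun k => W k a b
  unitary : ∀ k b c, ∑ a, starRingEnd ℂ (W k a b) * W k a c = if b = c then 1 else 0

variable {W : K → I → I → ℂ}

lemma IsUnitaryFamily.norm_le (hW : IsUnitaryFamily W) (k : K) (a b : I) : ‖W k a b‖ ≤ 1 := by
  have h1 := hW.unitary k b b
  rw [if_pos rfl] at h1
  have h2 : ∑ a, ‖W k a b‖ ^ 2 = 1 := by
    have : ((∑ a, ‖W k a b‖ ^ 2 : ℝ) : ℂ) = 1 := by
      rw [← h1]
      push_cast
      exact Finset.sum_congr rfl fun a _ => (Complex.conj_mul' _).symm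
    exact_mod_cast this
  have h3 : ‖W k a b‖ ^ 2 ≤ 1 := h2 ▸
    Finset.single_le_sum (f := fun a => ‖W k a b‖ ^ 2) (fun _ _ => by positivity)
      (Finset.mem_univ a)
  exact (sq_le_one_iff₀ (norm_nonneg _)).1 h3

lemma IsUnitaryFamily.sum_conj_mul (hW : IsUnitaryFamily W) (k : K) (x y : I → ℂ) :
    ∑ a, starRingEnd ℂ (∑ b, W k a b * x b) * ∑ c, W k a c * y c
      = ∑ b, starRingEnd ℂ (x b) * y b := by
  calc ∑ a, starRingEnd ℂ (∑ b, W k a b * x b) * ∑ c, W k a c * y c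
      = ∑ a, ∑ b, ∑ c, starRingEnd ℂ (x b) * y c * (starRingEnd ℂ (W k a b) * W k a c) := by
        refine Finset.sum_congr rfl fun a _ => ?_
        rw [map_sum, Finset.sum_mul_sum]
        refine Finset.sum_congr rfl fun b _ => Finset.sum_congr rfl fun c _ => ?_
        rw [map_mul]
        ring
    _ = ∑ b, ∑ c, starRingEnd ℂ (x b) * y c * ∑ a, starRingEnd ℂ (W k a b) * W k a c := by
        rw [Finset.sum_comm]
        refine Finset.sum_congr rfl fun b _ => ?_
        rw [Finset.sum_comm]
        exact Finset.sum_congr rfl fun c _ => by rw [Finset.mul_sum]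
    _ = _ := by simp [hW.unitary]

variable [MeasurableSpace I] [MeasurableSingletonClass I] [AddCommGroup K] [MeasurableNeg K]
  {ν : Measure K} [SigmaFinite ν] [ν.IsNegInvariant]

/-- The transformation `(U φ)(k, a) = ∑_b W(k)_{ab} φ(-k, b)`. -/
def reflect (W : K → I → I → ℂ) (φ : K × I → ℂ) (z : K × I) : ℂ :=
  ∑ b, W z.1 z.2 b * φ (-z.1, b)

lemma memLp_reflect (hW : IsUnitaryFamily W) {φ : K × I → ℂ}
    (hφ : MemLp φ 2 (ν.prod Measure.count)) : MemLp (reflect W φ) 2 (ν.prod Measure.count) := by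
  rw [memLp_prod_count_iff] at hφ ⊢
  intro a
  refine memLp_finsetSum _ fun b _ => ?_
  have h1 : MemLp (fun k => φ (-k, b)) 2 ν :=
    (hφ b).comp_measurePreserving (Measure.measurePreserving_neg ν)
  exact h1.of_le ((hW.measurable a b).aestronglyMeasurable.mul h1.1) (.of_forall fun k => by
    rw [norm_mul]
    exact mul_le_of_le_one_left (norm_nonneg _) (hW.norm_le k a b))

lemma integral_conj_reflect_mul_reflect (hW : IsUnitaryFamily W) {φ ψ : K × I → ℂ}
    (hφ : MemLp φ 2 (ν.prod Measure.count)) (hψ : MemLp ψ 2 (ν.prod Measure.count)) :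
    ∫ z, starRingEnd ℂ (reflect W φ z) * reflect W ψ z ∂ν.prod Measure.count
      = ∫ z, starRingEnd ℂ (φ z) * ψ z ∂ν.prod Measure.count := by
  rw [integral_prod_count (integrable_conj_mul (memLp_reflect hW hφ) (memLp_reflect hW hψ)),
    integral_prod_count (integrable_conj_mul hφ hψ)]
  simp only [reflect, hW.sum_conj_mul]
  exact integral_neg_eq_self (fun k => ∑ b, starRingEnd ℂ (φ (k, b)) * ψ (k, b)) ν

end Reflection

/-! ### Second quantization of the reflection -/

section SecondQuantization

instance (n : ℕ) : (volume : Measure (Fin n → R3)).IsNegInvariant :=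
  Measure.pi.isNegInvariant fun _ : Fin n => (volume : Measure R3)

/-- The tensor power `W^{⊗n}`. -/
def tensorPower (w : R3 → Fin 2 → Fin 2 → ℂ) (n : ℕ) (k : Fin n → R3) (a b : Fin n → Fin 2) : ℂ :=
  ∏ i, w (k i) (a i) (b i)

lemma isUnitaryFamily_tensorPower {w : R3 → Fin 2 → Fin 2 → ℂ} (hw : IsUnitaryFamily w) (n : ℕ) :
    IsUnitaryFamily (tensorPower w n) where
  measurable a b := Finset.measurable_prod _ fun i _ =>
    (hw.measurable (a i) (b i)).comp (measurable_pi_apply i)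
  unitary k b c := by
    simp only [tensorPower, map_prod, ← Finset.prod_mul_distrib]
    rw [← Fintype.prod_sum fun i a => starRingEnd ℂ (w (k i) a (b i)) * w (k i) a (c i)]
    simp only [hw.unitary]
    by_cases h : b = c
    · simp [h]
    · obtain ⟨i, hi⟩ := Function.ne_iff.1 h
      rw [if_neg h]
      exact Finset.prod_eq_zero (Finset.mem_univ i) (if_neg hi)

/-- Separation of momenta and polarizations. -/
abbrev splitPol (n : ℕ) : (Fin n → Photon) ≃ᵐ (Fin n → R3) × (Fin n → Fin 2) :=
  MeasurableEquiv.arrowProdEquivProdArrow R3 (Fin 2) (Fin n)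

lemma pi_count (n : ℕ) : Measure.pi (fun _ : Fin n => (Measure.count : Measure (Fin 2)))
    = Measure.count := by
  refine Measure.ext_of_singleton fun a => ?_
  rw [Measure.pi_singleton]
  simp

lemma measurePreserving_splitPol (n : ℕ) : MeasurePreserving (splitPol n) (photonMeasureN n)
    ((volume : Measure (Fin n → R3)).prod Measure.count) := by
  have h := measurePreserving_arrowProdEquivProdArrow R3 (Fin 2) (Fin n)
    (fun _ => volume) (fun _ => Measure.count)
  rw [pi_count] at h
  exact h

/-- The `n`-photon transformation
`(U φ)(k₁,a₁,…,kₙ,aₙ) = ∑_b w(k₁)_{a₁b₁} ⋯ w(kₙ)_{aₙbₙ} φ(-k₁,b₁,…,-kₙ,bₙ)`. -/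
def twist (w : R3 → Fin 2 → Fin 2 → ℂ) (n : ℕ) (φ : (Fin n → Photon) → ℂ) (x : Fin n → Photon) :
    ℂ :=
  ∑ b : Fin n → Fin 2, (∏ i, w (x i).1 (x i).2 (b i)) * φ (fun i => (-(x i).1, b i))

lemma twist_eq_reflect (w : R3 → Fin 2 → Fin 2 → ℂ) (n : ℕ) (φ : (Fin n → Photon) → ℂ) :
    twist w n φ = reflect (tensorPower w n) (φ ∘ (splitPol n).symm) ∘ splitPol n := rfl

lemma ae_twist {n : ℕ} {s : (Fin n → Photon) → Prop} (h : ∀ᵐ x ∂photonMeasureN n, s x) :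
    ∀ᵐ x ∂photonMeasureN n, ∀ b : Fin n → Fin 2, s (fun i => (-(x i).1, b i)) := by
  have h1 := ae_reflect
    ((measurePreserving_splitPol n).symm (splitPol n) |>.quasiMeasurePreserving.ae h)
  exact (measurePreserving_splitPol n).quasiMeasurePreserving.ae h1

variable {w : R3 → Fin 2 → Fin 2 → ℂ}

lemma memLp_twist (hw : IsUnitaryFamily w) {n : ℕ} {φ : (Fin n → Photon) → ℂ}
    (hφ : MemLp φ 2 (photonMeasureN n)) : MemLp (twist w n φ) 2 (photonMeasureN n) := by
  rw [twist_eq_reflect]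
  exact (memLp_reflect (isUnitaryFamily_tensorPower hw n) (hφ.comp_measurePreserving
    ((measurePreserving_splitPol n).symm (splitPol n)))).comp_measurePreserving
    (measurePreserving_splitPol n)

lemma integral_conj_twist_mul_twist (hw : IsUnitaryFamily w) {n : ℕ} {φ ψ : (Fin n → Photon) → ℂ}
    (hφ : MemLp φ 2 (photonMeasureN n)) (hψ : MemLp ψ 2 (photonMeasureN n)) :
    ∫ x, starRingEnd ℂ (twist w n φ x) * twist w n ψ x ∂photonMeasureN n
      = ∫ x, starRingEnd ℂ (φ x) * ψ x ∂photonMeasureN n := by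
  have hs := (measurePreserving_splitPol n).symm (splitPol n)
  have h1 := integral_conj_reflect_mul_reflect (isUnitaryFamily_tensorPower hw n)
    (hφ.comp_measurePreserving hs) (hψ.comp_measurePreserving hs)
  rw [twist_eq_reflect, twist_eq_reflect]
  refine ((measurePreserving_splitPol n).integral_comp' (f := splitPol n) (fun z =>
    starRingEnd ℂ (reflect (tensorPower w n) (φ ∘ (splitPol n).symm) z)
      * reflect (tensorPower w n) (ψ ∘ (splitPol n).symm) z)).trans (h1.trans ?_)
  exact hs.integral_comp' (f := (splitPol n).symm) fun x => starRingEnd ℂ (φ x) * ψ x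

lemma twist_comp_perm (n : ℕ) (s : Equiv.Perm (Fin n)) (φ : (Fin n → Photon) → ℂ)
    (x : Fin n → Photon) :
    twist w n φ (fun i => x (s i)) = twist w n (fun z => φ (fun i => z (s i))) x := by
  refine (Fintype.sum_equiv (s.arrowCongr (Equiv.refl (Fin 2))).symm _ _ fun b => ?_).symm
  congr 1
  exact (Equiv.prod_comp s fun i => w (x i).1 (x i).2 (b i)).symm

lemma twist_congr_ae {n : ℕ} {φ ψ : (Fin n → Photon) → ℂ} (h : φ =ᵐ[photonMeasureN n] ψ) :
    twist w n φ =ᵐ[photonMeasureN n] twist w n ψ := by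
  filter_upwards [ae_twist h] with x hx
  exact Finset.sum_congr rfl fun b _ => by rw [hx b]

lemma memLp_comp (Ψ : Fock) (n : ℕ) : MemLp (comp Ψ n) 2 (photonMeasureN n) :=
  Lp.memLp (Ψ n : Lp ℂ 2 (photonMeasureN n))

lemma comp_perm (Ψ : Fock) (n : ℕ) (s : Equiv.Perm (Fin n)) :
    ∀ᵐ x ∂photonMeasureN n, comp Ψ n (fun i => x (s i)) = comp Ψ n x :=
  (Ψ n).2 s

lemma inner_eq_integral (Ψ Φ : Fock) (n : ℕ) : inner ℂ (Ψ n) (Φ n)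
    = ∫ x, starRingEnd ℂ (comp Ψ n x) * comp Φ n x ∂photonMeasureN n := by
  rw [Submodule.coe_inner, L2.inner_def]
  exact integral_congr_ae (.of_forall fun x => mul_comm _ _)

/-- The `n`-photon component of `Γ Ψ`. -/
def parityN (hw : IsUnitaryFamily w) (Ψ : Fock) (n : ℕ) : NPhoton n :=
  ⟨(memLp_twist hw (memLp_comp Ψ n)).toLp, fun s => by
    have h1 := (memLp_twist hw (memLp_comp Ψ n)).coeFn_toLp
    filter_upwards [h1, (measurePreserving_perm s).quasiMeasurePreserving.ae h1,
      twist_congr_ae (w := w) (comp_perm Ψ n s)] with x h2 h3 h4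
    rw [h2, h3, twist_comp_perm, h4]⟩

lemma norm_parityN (hw : IsUnitaryFamily w) (Ψ : Fock) (n : ℕ) :
    ‖parityN hw Ψ n‖ = ‖Ψ n‖ := by
  have h1 : inner ℂ (parityN hw Ψ n) (parityN hw Ψ n) = inner ℂ (Ψ n) (Ψ n) := by
    rw [inner_eq_integral, ← integral_conj_twist_mul_twist hw (memLp_comp Ψ n) (memLp_comp Ψ n),
      Submodule.coe_inner, L2.inner_def]
    refine integral_congr_ae ?_
    filter_upwards [(memLp_twist hw (memLp_comp Ψ n)).coeFn_toLp] with x hx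
    have hx' : (parityN hw Ψ n : Lp ℂ 2 (photonMeasureN n)) x = twist w n (comp Ψ n) x := hx
    rw [hx']
    exact mul_comm _ _
  rw [@norm_eq_sqrt_re_inner ℂ, @norm_eq_sqrt_re_inner ℂ _ _ _ _ (Ψ n), h1]

/-- The second quantization `Γ` of the one-photon transformation `u f(k,a) = ∑_b w(k)_{ab} f(-k,b)`,
as a map of Fock space. -/
def parityFun (hw : IsUnitaryFamily w) (Ψ : Fock) : Fock :=
  ⟨fun n => parityN hw Ψ n, by
    have h := lp.memℓp Ψ
    have h2 : 0 < (2 : ENNReal).toReal := by norm_num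
    refine (memℓp_gen_iff h2).2 ?_
    simp only [norm_parityN]
    exact (memℓp_gen_iff h2).1 h⟩

lemma comp_parityFun (hw : IsUnitaryFamily w) (Ψ : Fock) (n : ℕ) :
    ∀ᵐ x ∂photonMeasureN n, comp (parityFun hw Ψ) n x = twist w n (comp Ψ n) x :=
  (memLp_twist hw (memLp_comp Ψ n)).coeFn_toLp

lemma inner_parityFun (hw : IsUnitaryFamily w) (Ψ Φ : Fock) :
    inner ℂ (parityFun hw Ψ) (parityFun hw Φ) = inner ℂ Ψ Φ := by
  rw [lp.inner_eq_tsum, lp.inner_eq_tsum]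
  refine tsum_congr fun n => ?_
  rw [inner_eq_integral, inner_eq_integral,
    ← integral_conj_twist_mul_twist hw (memLp_comp Ψ n) (memLp_comp Φ n)]
  refine integral_congr_ae ?_
  filter_upwards [comp_parityFun hw Ψ n, comp_parityFun hw Φ n] with x h1 h2
  rw [h1, h2]

lemma norm_parityFun (hw : IsUnitaryFamily w) (Ψ : Fock) : ‖parityFun hw Ψ‖ = ‖Ψ‖ := by
  have h := inner_parityFun hw Ψ Ψ
  rw [inner_self_eq_norm_sq_to_K, inner_self_eq_norm_sq_to_K] at h
  have h' : ‖parityFun hw Ψ‖ ^ 2 = ‖Ψ‖ ^ 2 := by exact_mod_cast h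
  exact (sq_eq_sq₀ (norm_nonneg _) (norm_nonneg _)).1 h'

lemma parityFun_add (hw : IsUnitaryFamily w) (Ψ Φ : Fock) :
    parityFun hw (Ψ + Φ) = parityFun hw Ψ + parityFun hw Φ := ext_comp fun n => by
  filter_upwards [comp_parityFun hw (Ψ + Φ) n, comp_parityFun hw Ψ n, comp_parityFun hw Φ n,
    comp_add (parityFun hw Ψ) (parityFun hw Φ) n, ae_twist (comp_add Ψ Φ n)] with x h1 h2 h3 h4 h5
  rw [h1, h4, h2, h3]
  simp only [twist, h5, mul_add, Finset.sum_add_distrib]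

lemma parityFun_smul (hw : IsUnitaryFamily w) (c : ℂ) (Ψ : Fock) :
    parityFun hw (c • Ψ) = c • parityFun hw Ψ := ext_comp fun n => by
  filter_upwards [comp_parityFun hw (c • Ψ) n, comp_parityFun hw Ψ n,
    comp_smul c (parityFun hw Ψ) n, ae_twist (comp_smul c Ψ n)] with x h1 h2 h3 h4
  rw [h1, h3, h2]
  simp only [twist, h4, Finset.mul_sum]
  exact Finset.sum_congr rfl fun b _ => by ring

/-- The bounded operator `Γ` on Fock space. -/
def parity (hw : IsUnitaryFamily w) : Fock →L[ℂ] Fock :=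
  LinearMap.mkContinuous
    { toFun := parityFun hw
      map_add' := parityFun_add hw
      map_smul' := parityFun_smul hw } 1
    fun Ψ => ((norm_parityFun hw Ψ).trans (one_mul _).symm).le

lemma comp_parity (hw : IsUnitaryFamily w) (Ψ : Fock) (n : ℕ) :
    ∀ᵐ x ∂photonMeasureN n, comp (parity hw Ψ) n x = twist w n (comp Ψ n) x :=
  comp_parityFun hw Ψ n

lemma inner_parity (hw : IsUnitaryFamily w) (Ψ Φ : Fock) :
    inner ℂ (parity hw Ψ) (parity hw Φ) = inner ℂ Ψ Φ :=
  inner_parityFun hw Ψ Φ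

end SecondQuantization

/-! ### Completeness of Fock space and symmetry of the field operators -/

section Symmetry

instance (n : ℕ) : CompleteSpace (NPhoton n) := by
  have h : IsClosed (NPhoton n : Set (Lp ℂ 2 (photonMeasureN n))) := by
    have h1 : (NPhoton n : Set (Lp ℂ 2 (photonMeasureN n))) = ⋂ s : Equiv.Perm (Fin n),
        {f | Lp.compMeasurePreserving _ (measurePreserving_perm s) f = f} := by
      ext f
      simp only [Set.mem_iInter, Set.mem_ofPred_eq, SetLike.mem_coe]
      refine forall_congr' fun s => ?_
      have h2 := Lp.coeFn_compMeasurePreserving f (measurePreserving_perm s)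
      constructor
      · intro h
        exact Lp.ext (h2.trans h)
      · intro h
        rw [h] at h2
        exact h2.symm
    rw [h1]
    exact isClosed_iInter fun s =>
      isClosed_eq (Lp.isometry_compMeasurePreserving (measurePreserving_perm s)).continuous
        continuous_id
  exact h.completeSpace_coe

lemma isFormalAdjoint_dGamma (h : R3 → ℝ) : (dGamma h).IsFormalAdjoint (dGamma h) := by
  rw [isFormalAdjoint_iff_graph, dGamma_graph]
  intro z hz w hw
  rw [lp.inner_eq_tsum, lp.inner_eq_tsum]
  refine tsum_congr fun n => ?_
  rw [inner_eq_integral, inner_eq_integral]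
  refine integral_congr_ae ?_
  filter_upwards [hz n, hw n] with x h1 h2
  rw [h1, h2, map_mul, Complex.conj_ofReal]
  ring

/-- `(y, x₁, …, xₙ)` as an `(n+1)`-photon configuration. -/
abbrev consEquiv (n : ℕ) : Photon × (Fin n → Photon) ≃ᵐ (Fin (n + 1) → Photon) :=
  (MeasurableEquiv.piFinSuccAbove (fun _ : Fin (n + 1) => Photon) 0).symm

lemma consEquiv_apply (n : ℕ) (y : Photon) (x : Fin n → Photon) :
    consEquiv n (y, x) = Fin.cons y x := by
  simp [Fin.consEquiv]

lemma measurePreserving_consEquiv (n : ℕ) : MeasurePreserving (consEquiv n)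
    (photonMeasure.prod (photonMeasureN n)) (photonMeasureN (n + 1)) :=
  (measurePreserving_piFinSuccAbove (fun _ : Fin (n + 1) => photonMeasure) 0).symm

lemma ae_memLp_cons {n : ℕ} {φ : (Fin (n + 1) → Photon) → ℂ}
    (hφ : MemLp φ 2 (photonMeasureN (n + 1))) : ∀ᵐ x ∂photonMeasureN n,
      MemLp (fun y => φ (Fin.cons y x : Fin (n + 1) → Photon)) 2 photonMeasure := by
  have h1 := (hφ.comp_measurePreserving (measurePreserving_consEquiv n)).comp_measurePreserving
    (Measure.measurePreserving_swap (μ := photonMeasureN n) (ν := photonMeasure))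
  filter_upwards [h1.1.prodMk_left, ((memLp_two_iff_integrable_sq_norm h1.1).1 h1).prod_right_ae]
    with x h2 h3
  have h4 := (memLp_two_iff_integrable_sq_norm h2).2 h3
  simpa only [Function.comp_def, Prod.swap_prod_mk, consEquiv_apply] using h4

variable {f : Photon → ℂ}

lemma memLp_tensor (hf : MemLp f 2 photonMeasure) {n : ℕ} {φ : (Fin n → Photon) → ℂ}
    (hφ : MemLp φ 2 (photonMeasureN n)) :
    MemLp (fun z : Fin (n + 1) → Photon => f (z 0) * φ (fun i => z i.succ)) 2
      (photonMeasureN (n + 1)) := by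
  have h1 : AEStronglyMeasurable (fun p : Photon × (Fin n → Photon) => f p.1 * φ p.2)
      (photonMeasure.prod (photonMeasureN n)) := hf.1.comp_fst.mul hφ.1.comp_snd
  have h2 : MemLp (fun p : Photon × (Fin n → Photon) => f p.1 * φ p.2) 2
      (photonMeasure.prod (photonMeasureN n)) := by
    rw [memLp_two_iff_integrable_sq_norm h1]
    simp only [norm_mul, mul_pow]
    exact ((memLp_two_iff_integrable_sq_norm hf.1).1 hf).mul_prod
      ((memLp_two_iff_integrable_sq_norm hφ.1).1 hφ)
  have h3 := h2.comp_measurePreserving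
    ((measurePreserving_consEquiv n).symm (consEquiv n))
  exact h3

/-- One level of the adjointness of `a(f)` and `a(f)*`: all summands of the creation operator
contribute equally, by permutation symmetry, and Fubini's theorem applies to the first. -/
lemma inner_creation_level (hf : MemLp f 2 photonMeasure) {n : ℕ} {φ : (Fin n → Photon) → ℂ}
    {ψ : (Fin (n + 1) → Photon) → ℂ} (hφ : MemLp φ 2 (photonMeasureN n))
    (hψ : MemLp ψ 2 (photonMeasureN (n + 1)))
    (hsym : ∀ s : Equiv.Perm (Fin (n + 1)), ∀ᵐ z ∂photonMeasureN (n + 1),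
      ψ (fun i => z (s i)) = ψ z) :
    ∫ z, starRingEnd ℂ (((Real.sqrt (n + 1))⁻¹ : ℂ) *
        ∑ j : Fin (n + 1), f (z j) * φ (fun i => z (j.succAbove i))) * ψ z
          ∂photonMeasureN (n + 1)
      = ∫ x, starRingEnd ℂ (φ x) * ((Real.sqrt (n + 1) : ℂ) * ∫ y, starRingEnd ℂ (f y) *
        ψ (Fin.cons y x : Fin (n + 1) → Photon) ∂photonMeasure) ∂photonMeasureN n := by
  set G : (Fin (n + 1) → Photon) → ℂ := fun z =>
    starRingEnd ℂ (f (z 0) * φ (fun i => z i.succ)) * ψ z with hG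
  have hGi : Integrable G (photonMeasureN (n + 1)) := integrable_conj_mul (memLp_tensor hf hφ) hψ
  have hterm : ∀ j : Fin (n + 1),
      (fun z => starRingEnd ℂ (f (z j) * φ (fun i => z (j.succAbove i))) * ψ z)
        =ᵐ[photonMeasureN (n + 1)] fun z => G (fun i => z (j.cycleRange.symm i)) := by
    intro j
    filter_upwards [hsym j.cycleRange.symm] with z hz
    simp only [hG, Fin.cycleRange_symm_zero, Fin.cycleRange_symm_succ, hz]
  have hcomp : ∀ j : Fin (n + 1),
      Integrable (fun z => G (fun i => z (j.cycleRange.symm i))) (photonMeasureN (n + 1)) :=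
    fun j => (measurePreserving_perm j.cycleRange.symm).integrable_comp_of_integrable hGi
  have hint : ∀ j : Fin (n + 1), ∫ z, G (fun i => z (j.cycleRange.symm i))
      ∂photonMeasureN (n + 1) = ∫ z, G z ∂photonMeasureN (n + 1) := by
    intro j
    have hmp := measurePreserving_perm (n := n + 1) j.cycleRange.symm
    conv_rhs => rw [← hmp.map_eq]
    rw [integral_map hmp.measurable.aemeasurable (by rw [hmp.map_eq]; exact hGi.1)]
  have hFub : ∫ z, G z ∂photonMeasureN (n + 1) = ∫ x, starRingEnd ℂ (φ x) *
      ∫ y, starRingEnd ℂ (f y) * ψ (Fin.cons y x : Fin (n + 1) → Photon) ∂photonMeasure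
        ∂photonMeasureN n := by
    rw [← (measurePreserving_consEquiv n).integral_comp' (f := consEquiv n) G,
      integral_prod_symm (fun p => G (consEquiv n p))
        ((measurePreserving_consEquiv n).integrable_comp_of_integrable hGi)]
    refine integral_congr_ae (.of_forall fun x => ?_)
    simp only [consEquiv_apply, hG, Fin.cons_zero, Fin.cons_succ, map_mul]
    rw [← integral_const_mul]
    exact integral_congr_ae (.of_forall fun y => by ring)
  have hsqrt : ((Real.sqrt (n + 1))⁻¹ : ℂ) * (n + 1) = (Real.sqrt (n + 1) : ℂ) := by
    have h0 : (0 : ℝ) < n + 1 := by positivity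
    have h1 : (Real.sqrt (n + 1) : ℂ) ≠ 0 := by
      exact_mod_cast (Real.sqrt_pos.2 h0).ne'
    have h2 : (Real.sqrt (n + 1) : ℂ) * (Real.sqrt (n + 1) : ℂ) = (n + 1 : ℂ) := by
      exact_mod_cast congrArg (fun t : ℝ => (t : ℂ)) (Real.mul_self_sqrt h0.le)
    rw [inv_mul_eq_div, div_eq_iff h1, h2]
  calc ∫ z, starRingEnd ℂ (((Real.sqrt (n + 1))⁻¹ : ℂ) *
        ∑ j : Fin (n + 1), f (z j) * φ (fun i => z (j.succAbove i))) * ψ z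
          ∂photonMeasureN (n + 1)
      = ∫ z, ((Real.sqrt (n + 1))⁻¹ : ℂ) *
          ∑ j : Fin (n + 1), G (fun i => z (j.cycleRange.symm i)) ∂photonMeasureN (n + 1) := by
        refine integral_congr_ae ?_
        filter_upwards [ae_all_iff.2 hterm] with z hz
        simp only [← hz, map_mul, map_sum, map_inv₀, Complex.conj_ofReal, Finset.sum_mul,
          Finset.mul_sum, mul_assoc]
    _ = (Real.sqrt (n + 1) : ℂ) * ∫ z, G z ∂photonMeasureN (n + 1) := by
        rw [integral_const_mul, integral_finsetSum _ fun j _ => hcomp j]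
        simp only [hint, Finset.sum_const, Finset.card_univ, Fintype.card_fin, nsmul_eq_mul]
        rw [← mul_assoc]
        push_cast
        rw [hsqrt]
    _ = _ := by
        rw [hFub, ← integral_const_mul]
        exact integral_congr_ae (.of_forall fun x => by ring)

/-- `a(f)*` and `a(f)` are formally adjoint to each other. -/
lemma inner_creation (hf : MemLp f 2 photonMeasure) {P Q : Fock × Fock}
    (hP : P ∈ creationGraph f) (hQ : Q ∈ annihilationGraph f) :
    inner ℂ P.2 Q.1 = inner ℂ P.1 Q.2 := by
  have h0 : inner ℂ (P.2 0) (Q.1 0) = (0 : ℂ) := by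
    rw [inner_eq_integral]
    refine integral_eq_zero_of_ae ?_
    filter_upwards [hP.1] with x hx
    rw [hx, map_zero, zero_mul, Pi.zero_apply]
  have hs : Summable fun n => (inner ℂ (P.2 n) (Q.1 n) : ℂ) := lp.summable_inner P.2 Q.1
  have hs' : ∑' n, (inner ℂ (P.2 n) (Q.1 n) : ℂ) = ∑' n, inner ℂ (P.2 (n + 1)) (Q.1 (n + 1)) := by
    rw [hs.tsum_eq_zero_add, h0, zero_add]
  rw [lp.inner_eq_tsum, lp.inner_eq_tsum, hs']
  refine tsum_congr fun n => ?_
  rw [inner_eq_integral, inner_eq_integral]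
  have h1 := inner_creation_level hf (memLp_comp P.1 n) (memLp_comp Q.1 (n + 1))
    (comp_perm Q.1 (n + 1))
  refine (integral_congr_ae ?_).trans (h1.trans (integral_congr_ae ?_))
  · filter_upwards [hP.2 n] with z hz
    rw [hz]
  · filter_upwards [hQ n] with x hx
    rw [hx.2]

lemma isFormalAdjoint_segalField (hf : MemLp f 2 photonMeasure) :
    (segalField f).IsFormalAdjoint (segalField f) := by
  refine isFormalAdjoint_smul ?_ (isFormalAdjoint_closure ?_)
  · rw [map_inv₀, Complex.conj_ofReal]
  · rw [isFormalAdjoint_iff_graph]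
    intro z hz w hw
    obtain ⟨a, b, ha, hb, h⟩ := mem_graph_add.1 hz
    obtain ⟨a', b', ha', hb', h'⟩ := mem_graph_add.1 hw
    rw [annihilation_graph] at ha ha'
    rw [creation_graph] at hb hb'
    have h1 : inner ℂ b w.1 = inner ℂ z.1 a' := inner_creation hf hb ha'
    have h2 : inner ℂ b' z.1 = inner ℂ w.1 a := inner_creation hf hb' ha
    have h3 : inner ℂ a w.1 = inner ℂ z.1 b' := by
      rw [← inner_conj_symm, ← h2, inner_conj_symm]
    rw [h, h', inner_add_left, inner_add_right, h1, h3, add_comm]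

end Symmetry

/-! ### Parity and the field operators -/

section Intertwining

variable {w : R3 → Fin 2 → Fin 2 → ℂ} {f : Photon → ℂ}

lemma intertwines_dGamma (hw : IsUnitaryFamily w) {h : R3 → ℝ} {c : ℝ}
    (hc : c * c = 1) (hh : ∀ k, h (-k) = c * h k) :
    Intertwines (parity hw) (c : ℂ) (dGamma h) := by
  have hcc : (c : ℂ) * c = 1 := by exact_mod_cast hc
  intro z hz
  rw [dGamma_graph] at hz ⊢
  intro n
  filter_upwards [ae_twist (hz n), comp_parity hw z.1 n, comp_parity hw z.2 n,
    comp_smul (c : ℂ) (parity hw z.2) n] with x h1 h2 h3 h4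
  rw [h4, h3, h2]
  simp only [twist, h1, hh, ← Finset.mul_sum]
  simp only [Finset.mul_sum (s := (Finset.univ : Finset (Fin n → Fin 2)))]
  refine Finset.sum_congr rfl fun b _ => ?_
  rw [Complex.ofReal_mul]
  linear_combination (((∑ i, h (x i).1 : ℝ) : ℂ) * ((∏ i, w (x i).1 (x i).2 (b i)) *
    comp z.1 n fun i => (-(x i).1, b i))) * hcc

/-- Splitting off the polarization index of the `j`-th photon. -/
lemma sum_prod_succAbove {n : ℕ} (z : Fin (n + 1) → Photon) (j : Fin (n + 1))
    (G : (Fin (n + 1) → Fin 2) → ℂ) :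
    ∑ b, (∏ i, w (z i).1 (z i).2 (b i)) * G b
      = ∑ b : Fin n → Fin 2, (∏ i, w (z (j.succAbove i)).1 (z (j.succAbove i)).2 (b i)) *
        ∑ a, w (z j).1 (z j).2 a * G (j.insertNth a b) := by
  rw [← (Fin.insertNthEquiv (fun _ : Fin (n + 1) => Fin 2) j).sum_comp, Fintype.sum_prod_type,
    Finset.sum_comm]
  refine Finset.sum_congr rfl fun b _ => ?_
  rw [Finset.mul_sum]
  refine Finset.sum_congr rfl fun a _ => ?_
  have hab : Fin.insertNthEquiv (fun _ => Fin 2) j (a, b)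
      = Fin.insertNth (α := fun _ => Fin 2) j a b := rfl
  rw [hab]
  rw [Fin.prod_univ_succAbove _ j]
  simp only [Fin.insertNth_apply_same, Fin.insertNth_apply_succAbove]
  ring

lemma twist_cons {n : ℕ} (φ : (Fin (n + 1) → Photon) → ℂ) (y : Photon) (x : Fin n → Photon) :
    twist w (n + 1) φ (Fin.cons y x) = ∑ b : Fin n → Fin 2, (∏ i, w (x i).1 (x i).2 (b i)) *
      reflect w (fun y' => φ (Fin.cons y' fun i => (-(x i).1, b i))) y := by
  rw [twist, sum_prod_succAbove _ 0]
  refine Finset.sum_congr rfl fun b _ => ?_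
  simp only [Fin.succAbove_zero, Fin.cons_succ, Fin.cons_zero, reflect]
  congr 1
  refine Finset.sum_congr rfl fun a _ => ?_
  congr 2
  ext1 i
  refine Fin.cases ?_ (fun i => ?_) i <;> simp

/-- If `u f = -f`, then `Γ a(f) = -a(f) Γ` on the domain of `a(f)`. -/
lemma parity_annihilation (hw : IsUnitaryFamily w) (hf : MemLp f 2 photonMeasure)
    (hodd : ∀ᵐ y ∂photonMeasure, reflect w f y = -f y) {P : Fock × Fock}
    (hP : P ∈ annihilationGraph f) :
    (parity hw P.1, (-1 : ℂ) • parity hw P.2) ∈ annihilationGraph f := by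
  intro n
  filter_upwards [ae_twist (hP n), ae_twist (ae_memLp_cons (memLp_comp P.1 (n + 1))),
    ae_cons (comp_parity hw P.1 (n + 1)), comp_parity hw P.2 n,
    comp_smul (-1) (parity hw P.2) n] with x h1 h2 h3 h4 h5
  set ψ : (Fin n → Fin 2) → Photon → ℂ := fun b y =>
    comp P.1 (n + 1) (Fin.cons y fun i => (-(x i).1, b i)) with hψ
  have hae : (fun y => starRingEnd ℂ (f y) *
        comp (parity hw P.1) (n + 1) (Fin.cons y x : Fin (n + 1) → Photon))
      =ᵐ[photonMeasure] fun y => ∑ b : Fin n → Fin 2, (-∏ i, w (x i).1 (x i).2 (b i)) *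
        (starRingEnd ℂ (reflect w f y) * reflect w (ψ b) y) := by
    filter_upwards [h3, hodd] with y hy hy'
    rw [hy, hy', twist_cons, Finset.mul_sum]
    refine Finset.sum_congr rfl fun b _ => ?_
    rw [map_neg]
    ring
  have hint : ∀ b, Integrable (fun y => starRingEnd ℂ (reflect w f y) * reflect w (ψ b) y)
      photonMeasure := fun b =>
    integrable_conj_mul (memLp_reflect hw hf) (memLp_reflect hw (h2 b))
  refine ⟨(integrable_finsetSum _ fun b _ => (hint b).const_mul _).congr hae.symm, ?_⟩
  have hiso : ∀ b, ∫ y, starRingEnd ℂ (reflect w f y) * reflect w (ψ b) y ∂photonMeasure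
      = ∫ y, starRingEnd ℂ (f y) * ψ b y ∂photonMeasure := fun b =>
    integral_conj_reflect_mul_reflect hw hf (h2 b)
  rw [integral_congr_ae hae, integral_finsetSum _ fun b _ => (hint b).const_mul _, h5, h4]
  simp only [integral_const_mul, hiso, twist, Finset.mul_sum]
  refine Finset.sum_congr rfl fun b _ => ?_
  rw [(h1 b).2]
  ring

lemma ae_eval {n : ℕ} {s : Photon → Prop} (h : ∀ᵐ y ∂photonMeasure, s y) (j : Fin n) :
    ∀ᵐ x ∂photonMeasureN n, s (x j) :=
  (Measure.quasiMeasurePreserving_eval (fun _ : Fin n => photonMeasure) j).ae h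

/-- If `u f = -f`, then `Γ a(f)* = -a(f)* Γ` on the domain of `a(f)*`. -/
lemma parity_creation (hw : IsUnitaryFamily w)
    (hodd : ∀ᵐ y ∂photonMeasure, reflect w f y = -f y) {P : Fock × Fock}
    (hP : P ∈ creationGraph f) :
    (parity hw P.1, (-1 : ℂ) • parity hw P.2) ∈ creationGraph f := by
  refine ⟨?_, fun n => ?_⟩
  · filter_upwards [ae_twist hP.1, comp_parity hw P.2 0, comp_smul (-1) (parity hw P.2) 0]
      with x h1 h2 h3
    rw [h3, h2, twist, Finset.sum_eq_zero, mul_zero]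
    intro b _
    rw [h1 b, mul_zero]
  · filter_upwards [ae_twist (hP.2 n), comp_parity hw P.2 (n + 1),
      comp_smul (-1) (parity hw P.2) (n + 1),
      ae_all_iff.2 fun j => ae_remove j (comp_parity hw P.1 n),
      ae_all_iff.2 fun j : Fin (n + 1) => ae_eval hodd j] with x h1 h2 h3 h4 h5
    rw [h3, h2]
    have h6 : ∀ j, f (x j) * comp (parity hw P.1) n (fun i => x (j.succAbove i))
        = -∑ b : Fin (n + 1) → Fin 2, (∏ i, w (x i).1 (x i).2 (b i)) * (f (-(x j).1, b j) *
          comp P.1 n fun i => (-(x (j.succAbove i)).1, b (j.succAbove i))) := by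
      intro j
      have h7 : f (x j) = -reflect w f (x j) := by rw [h5 j, neg_neg]
      rw [h4 j, h7, sum_prod_succAbove x j, neg_mul, twist, Finset.mul_sum]
      congr 1
      refine Finset.sum_congr rfl fun b _ => ?_
      simp only [Fin.insertNth_apply_same, Fin.insertNth_apply_succAbove, ← mul_assoc,
        ← Finset.sum_mul, reflect]
      ring
    simp only [h6, twist, h1, Finset.sum_neg_distrib]
    rw [Finset.sum_comm]
    simp only [Finset.mul_sum, ← Finset.sum_neg_distrib]
    exact Finset.sum_congr rfl fun b _ => Finset.sum_congr rfl fun j _ => by ring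

lemma intertwines_segalField (hw : IsUnitaryFamily w) (hf : MemLp f 2 photonMeasure)
    (hodd : ∀ᵐ y ∂photonMeasure, reflect w f y = -f y) :
    Intertwines (parity hw) (-1) (segalField f) := by
  refine Intertwines.smul _ (Intertwines.closure (Intertwines.add ?_ ?_))
  · intro z hz
    rw [annihilation_graph] at hz ⊢
    exact parity_annihilation hw hf hodd hz
  · intro z hz
    rw [creation_graph] at hz ⊢
    exact parity_creation hw hodd hz

end Intertwining

/-! ### The polarization matrices -/

section Polarization

variable {e : Fin 2 → R3 → R3}

lemma IsPolarization.norm_eq_one (he : IsPolarization e) (l : Fin 2) (k : R3) : ‖e l k‖ = 1 := by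
  have h := he.orthonormal k l l
  rw [if_pos rfl, real_inner_self_eq_norm_sq] at h
  exact (pow_eq_one_iff_of_nonneg (norm_nonneg _) two_ne_zero).1 h

/-- The two polarization vectors at `k` span the plane orthogonal to `k ≠ 0`. -/
lemma IsPolarization.sum_inner_smul (he : IsPolarization e) {k : R3} (hk : k ≠ 0) {v : R3}
    (hv : inner ℝ v k = 0) : ∑ l, inner ℝ (e l k) v • e l k = v := by
  have hnk : ‖k‖ ≠ 0 := norm_ne_zero_iff.2 hk
  have ht : ∀ l, inner ℝ k (e l k) = 0 := fun l => by rw [real_inner_comm, he.transverse]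
  have hon : Orthonormal ℝ ![e 0 k, e 1 k, ‖k‖⁻¹ • k] := by
    rw [orthonormal_iff_ite]
    intro i j
    fin_cases i <;> fin_cases j <;>
      simp [he.orthonormal, he.transverse, he.norm_eq_one, ht, inner_smul_left, inner_smul_right,
        norm_smul, hnk]
  let b := OrthonormalBasis.mk hon (by
    rw [top_le_iff]
    refine hon.linearIndependent.span_eq_top_of_card_eq_finrank ?_
    simp)
  have h := b.sum_repr v
  have h0 : b 0 = e 0 k := by simp [b]
  have h1 : b 1 = e 1 k := by simp [b]
  have h2 : b 2 = ‖k‖⁻¹ • k := by simp [b]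
  rw [Fin.sum_univ_three] at h
  simp only [OrthonormalBasis.repr_apply_apply, h0, h1, h2] at h
  rw [real_inner_smul_left, real_inner_comm v k, hv, mul_zero, zero_smul, add_zero] at h
  rw [Fin.sum_univ_two]
  exact h

lemma IsPolarization.sum_inner_smul_neg (he : IsPolarization e) (k : R3) (l : Fin 2) :
    ∑ b, inner ℝ (e b (-k)) (e l k) • e b (-k) = e l k := by
  by_cases hk : k = 0
  · subst hk
    simp [he.orthonormal]
  · refine he.sum_inner_smul (neg_ne_zero.2 hk) ?_
    rw [inner_neg_right, he.transverse, neg_zero]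

lemma IsPolarization.sum_inner_mul_inner (he : IsPolarization e) (k : R3) (b c : Fin 2) :
    ∑ a, inner ℝ (e a k) (e b (-k)) * inner ℝ (e a k) (e c (-k))
      = if b = c then (1 : ℝ) else 0 := by
  have h := he.sum_inner_smul_neg (-k) b
  rw [neg_neg] at h
  rw [← he.orthonormal (-k) b c]
  conv_rhs => rw [← h]
  simp only [sum_inner, inner_smul_left, conj_trivial]

variable {ρ : R3 → ℂ}

lemma memLp_formFactor (he : IsPolarization e) (hρ : MemLp ρ 2 volume)
    (hρω : MemLp (fun k => ((‖k‖⁻¹ : ℝ) : ℂ) * ρ k) 2 volume) (j : Fin 3) :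
    MemLp (formFactor ρ e j) 2 photonMeasure := by
  refine memLp_prod_count_iff.2 fun l => ?_
  refine (hρ.norm.add hρω.norm).of_le ?_ (.of_forall fun k => ?_)
  · have h1 : Measurable fun k : R3 => ((‖k‖ ^ (-(1 / 2) : ℝ) : ℝ) : ℂ) := by fun_prop
    have h2 : Measurable fun k : R3 => ((e l k j : ℝ) : ℂ) := by
      have := he.measurable l
      fun_prop
    exact (h1.aestronglyMeasurable.mul hρ.1).mul h2.aestronglyMeasurable
  · have h1 : ‖k‖ ^ (-(1 / 2) : ℝ) ≤ 1 + ‖k‖⁻¹ := by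
      rcases (norm_nonneg k).eq_or_lt with h0 | h0
      · rw [← h0, Real.zero_rpow (by norm_num)]
        simp
      · rcases le_total 1 ‖k‖ with h | h
        · have := Real.rpow_le_one_of_one_le_of_nonpos h (show (-(1 / 2) : ℝ) ≤ 0 by norm_num)
          have := inv_nonneg.2 h0.le
          linarith
        · have := Real.rpow_le_rpow_of_exponent_ge h0 h (show (-1 : ℝ) ≤ -(1 / 2) by norm_num)
          rw [Real.rpow_neg_one] at this
          linarith
    have h2 : ‖e l k j‖ ≤ 1 := by
      have := PiLp.norm_apply_le (e l k) j
      rwa [he.norm_eq_one] at this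
    have h3 : 0 ≤ ‖k‖ ^ (-(1 / 2) : ℝ) := by positivity
    have h4 : 0 ≤ ‖k‖⁻¹ := inv_nonneg.2 (norm_nonneg k)
    simp only [formFactor, Pi.add_apply, norm_mul, Complex.norm_real]
    rw [Real.norm_of_nonneg h3, Real.norm_of_nonneg h4,
      Real.norm_of_nonneg (add_nonneg (norm_nonneg (ρ k)) (mul_nonneg h4 (norm_nonneg (ρ k))))]
    calc ‖k‖ ^ (-(1 / 2) : ℝ) * ‖ρ k‖ * ‖e l k j‖ ≤ ‖k‖ ^ (-(1 / 2) : ℝ) * ‖ρ k‖ * 1 := by gcongr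
      _ ≤ (1 + ‖k‖⁻¹) * ‖ρ k‖ := by rw [mul_one]; gcongr
      _ = ‖ρ k‖ + ‖k‖⁻¹ * ‖ρ k‖ := by ring

/-- The phase `ρ(k)/ρ(-k)`, set to `1` where this quotient is not of modulus one (in particular
where `ρ(-k) = 0`), so that it has modulus one everywhere. -/
def parityPhase (ρ : R3 → ℂ) (k : R3) : ℂ :=
  open Classical in if ‖ρ k / ρ (-k)‖ = 1 then ρ k / ρ (-k) else 1

lemma norm_parityPhase (ρ : R3 → ℂ) (k : R3) : ‖parityPhase ρ k‖ = 1 := by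
  unfold parityPhase
  split_ifs with h
  · exact h
  · exact norm_one

lemma measurable_parityPhase (hρ : Measurable ρ) : Measurable (parityPhase ρ) := by
  have h : Measurable fun k => ρ k / ρ (-k) := hρ.div (hρ.comp measurable_neg)
  exact Measurable.ite (measurableSet_eq_fun h.norm measurable_const) h measurable_const

lemma parityPhase_mul {k : R3} (hk : ‖ρ k‖ = ‖ρ (-k)‖) : parityPhase ρ k * ρ (-k) = ρ k := by
  by_cases h0 : ρ (-k) = 0
  · rw [h0, norm_zero, norm_eq_zero] at hk
    rw [h0, hk, mul_zero]
  · have h : ‖ρ k / ρ (-k)‖ = 1 := by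
      rw [norm_div, hk, div_self (norm_ne_zero_iff.2 h0)]
    rw [parityPhase, if_pos h, div_mul_cancel₀ _ h0]

/-- The matrix `-c(k) e_a(k)·e_b(-k)`: the change of polarization basis from `-k` to `k`, with the
phase `c(k)` of the charge form factor and the sign of a polar vector. -/
def parityMatrix (ρ : R3 → ℂ) (e : Fin 2 → R3 → R3) (k : R3) (a b : Fin 2) : ℂ :=
  -(parityPhase ρ k * ((inner ℝ (e a k) (e b (-k)) : ℝ) : ℂ))

lemma isUnitaryFamily_parityMatrix (he : IsPolarization e) (hρ : Measurable ρ) :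
    IsUnitaryFamily (parityMatrix ρ e) where
  measurable a b := by
    have h1 := (he.measurable a)
    have h2 := (he.measurable b).comp measurable_neg
    exact ((measurable_parityPhase hρ).mul
      (Complex.measurable_ofReal.comp (h1.inner h2))).neg
  unitary k b c := by
    have h1 : starRingEnd ℂ (parityPhase ρ k) * parityPhase ρ k = 1 := by
      rw [Complex.conj_mul', norm_parityPhase]
      simp
    have h2 := congrArg (fun t : ℝ => (t : ℂ)) (he.sum_inner_mul_inner k b c)
    simp only [Complex.ofReal_sum, Complex.ofReal_mul, apply_ite (fun t : ℝ => (t : ℂ)),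
      Complex.ofReal_one, Complex.ofReal_zero] at h2
    rw [← h2]
    refine Finset.sum_congr rfl fun a _ => ?_
    rw [parityMatrix, parityMatrix, map_neg, map_mul, Complex.conj_ofReal]
    linear_combination ((inner ℝ (e a k) (e b (-k)) : ℝ) : ℂ) *
      ((inner ℝ (e a k) (e c (-k)) : ℝ) : ℂ) * h1

/-- The form factor of the vector potential is odd under parity. -/
lemma reflect_formFactor (he : IsPolarization e) {ρ₀ : R3 → ℂ}
    (h0 : ∀ᵐ k ∂(volume : Measure R3), ρ k = ρ₀ k)
    (hsymm : ∀ᵐ k ∂(volume : Measure R3), ‖ρ k‖ = ‖ρ (-k)‖) (j : Fin 3) :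
    ∀ᵐ y ∂photonMeasure,
      reflect (parityMatrix ρ₀ e) (formFactor ρ e j) y = -formFactor ρ e j y := by
  refine ae_prod_count_iff.2 ?_
  have h0' : ∀ᵐ k ∂(volume : Measure R3), ρ (-k) = ρ₀ (-k) :=
    (Measure.measurePreserving_neg volume).quasiMeasurePreserving.ae h0
  filter_upwards [h0, h0', hsymm] with k h1 h2 h3 l
  have h4 : parityPhase ρ₀ k * ρ (-k) = ρ k := by
    rw [h1, h2]
    refine parityPhase_mul ?_
    rw [← h1, ← h2, h3]
  have h5 : ∑ b, ((inner ℝ (e l k) (e b (-k)) : ℝ) : ℂ) * ((e b (-k) j : ℝ) : ℂ)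
      = ((e l k j : ℝ) : ℂ) := by
    have := congrArg (fun v : R3 => v j) (he.sum_inner_smul_neg k l)
    simp only [Fin.sum_univ_two, PiLp.add_apply, PiLp.smul_apply, smul_eq_mul] at this
    rw [Fin.sum_univ_two, ← this]
    push_cast
    rw [real_inner_comm (e 0 (-k)), real_inner_comm (e 1 (-k))]
  simp only [reflect, formFactor, parityMatrix, norm_neg]
  rw [← h5, ← h4, Finset.mul_sum, ← Finset.sum_neg_distrib]
  exact Finset.sum_congr rfl fun b _ => by ring

end Polarization

end DiracPolaron

end

theorem theoremT1p75
    (α : Fin 3 → Matrix (Fin 4) (Fin 4) ℂ) (β : Matrix (Fin 4) (Fin 4) ℂ)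
    (hD : DiracPolaron.IsDirac α β)
    (e : Fin 2 → DiracPolaron.R3 → DiracPolaron.R3) (he : DiracPolaron.IsPolarization e)
    (ρ : DiracPolaron.R3 → ℂ) (hρ : MemLp ρ 2 volume)
    (hρω : MemLp (fun k => ((‖k‖⁻¹ : ℝ) : ℂ) * ρ k) 2 volume)
    (M q m : ℝ) (hm : 0 ≤ m)
    (hsymm : ∀ᵐ k ∂(volume : Measure DiracPolaron.R3), ‖ρ k‖ = ‖ρ (-k)‖)
    (hgs : DiracPolaron.HasGroundState (DiracPolaron.hamiltonian α β M q m ρ e 0).closure)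
    (p : DiracPolaron.R3) (hp : p ≠ 0) :
    ⊥ < DiracPolaron.energy α β M q m ρ e p ∧
      DiracPolaron.energy α β M q m ρ e p < DiracPolaron.energy α β M q m ρ e 0 := by
  open DiracPolaron in
  -- a measurable representative of `ρ`, for the measurability of the phase `ρ(k)/ρ(-k)`
  have hw : IsUnitaryFamily (parityMatrix (hρ.1.mk ρ) e) :=
    isUnitaryFamily_parityMatrix he hρ.1.stronglyMeasurable_mk.measurable
  have hg := memLp_formFactor he hρ hρω
  refine energy_lt_of_parity hD isFormalAdjoint_dGamma
    (fun j => isFormalAdjoint_segalField (hg j)) (inner_parity hw) ?_ (fun j => ?_)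
    (fun j => intertwines_segalField hw (hg j) (reflect_formFactor he hρ.1.ae_eq_mk hsymm j))
    hgs hp
  · simpa using intertwines_dGamma hw (h := dispersion m) (one_mul 1)
      fun k => by simp [dispersion]
  · simpa using intertwines_dGamma hw (h := fun k => k j) (c := -1) (by norm_num)
      fun k => by simp
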